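/- **Setting.** Let $n\ge 1$ and let $\Omega\subseteq\mathbb R^n$ be a bounded connected open set with Lipschitz boundary $\Gamma=\partial\Omega$. Let $\Gamma_0,\Gamma_1$ be disjoint relatively open subsets of $\Gamma$ such that $\overline{\Gamma_0}\cup\overline{\Gamma_1}=\Gamma$ and $\overline{\Gamma_0}\cap\overline{\Gamma_1}$ is of Lipschitz class ($\Gamma_0$ may be empty). Let $H=L^2(\Omega)$ and $V=\{v\in H^1(\Omega): v|_{\Gamma_0}=0 \text{ in the sense of traces}\}$ with $(v_1,v_2)_V=\int_\Omega v_1v_2+\int_\Omega\nabla v_1\cdot\nabla v_2$. Let $V'$ be the dual of $V$, let $H\subset V'$ through $\langle h,v\rangle=(h,v)_H$, and let $A:V\to V'$ be given by $\langle Av_1,v_2\rangle=\int_\Omega\nabla v_1\cdot\nabla v_2$. Let $T>0$, $\varepsilon>0$, $Q=\Omega\times\,]0,T[$, and let $\psi:\mathbb R^2\to\mathbb R$ be Lipschitz continuous with constant $L$. The space $L^1(0,T;H)+L^2(0,T;V')$ carries the norm $\|h\|=\inf\{\|h_1\|_{L^1(0,T;H)}+\|h_2\|_{L^2(0,T;V')}\}$,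 the infimum being over all decompositions $h=h_1+h_2$ with $h_1\in L^1(0,T;H)$, $h_2\in L^2(0,T;V')$. Given $f\in L^1(0,T;H)+L^2(0,T;V')$, $u\in L^2(Q)$ and $\theta_0,\chi_0\in H$, a solution of $(P_\varepsilon)$ is a pair $(\theta,\chi)$ with $\theta\in L^2(0,T;V)\cap H^1(0,T;V')$, $\chi\in H^1(0,T;H)$, $$\theta'(t)+\chi'(t)+A\theta(t)=f(t)\ \text{ in } V' \text{ for a.e. } t\in\,]0,T[,\qquad \varepsilon\chi'=\psi(\theta+u,\chi)\ \text{ a.e. in } Q,$$ $$\theta(0)=\theta_0,\qquad \chi(0)=\chi_0 .$$ **Proposition 3.1.** There is a constant $C_\varepsilon>0$, depending only on $T$, $\varepsilon$ and $L$, such that the following holds. If, for $i=1,2$, $f_i\in L^1(0,T;H)+L^2(0,T;V')$, $u_i\in L^2(Q)$, $\theta_{0i},\chi_{0i}\in H$, and $(\theta_i,\chi_i)$ is a solution of $(P_\varepsilon)$ with data $f_i,u_i,\theta_{0i},\chi_{0i}$, then $\theta_i$ and $\chi_i$ have representatives in $C([0,T];H)$, which take the values $\theta_{0i}$ and $\chi_{0i}$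 at $t=0$, and for every $t\in[0,T]$ these satisfy $$\|\theta_1(t)-\theta_2(t)\|_H^2+\|\chi_1(t)-\chi_2(t)\|_H^2\le C_\varepsilon\big(\|\theta_{01}-\theta_{02}\|_H^2+\|\chi_{01}-\chi_{02}\|_H^2\big)+C_\varepsilon\big(\|f_1-f_2\|_{L^1(0,T;H)+L^2(0,T;V')}^2+\|u_1-u_2\|_{L^2(Q)}^2\big).$$ In particular, for given data, $(P_\varepsilon)$ has at most one solution. -/

import Mathlib

open Set Filter Topology MeasureTheory
open scoped ContDiff NNReal ENNReal

namespace StefanRelaxation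

/-- `ℝⁿ` with its Euclidean structure. -/
abbrev E (n : ℕ) : Type := EuclideanSpace ℝ (Fin n)

/-- `φ ∈ C_c^∞(U)`. -/
structure IsTestFunction {X : Type*} [NormedAddCommGroup X] [NormedSpace ℝ X]
    (U : Set X) (φ : X → ℝ) : Prop where
  contDiff : ContDiff ℝ ∞ φ
  hasCompactSupport : HasCompactSupport φ
  tsupport_subset : tsupport φ ⊆ U

section Domains

variable {n : ℕ}

/-- `∂Ω` is of Lipschitz class: near each boundary point, `Ω` is, in suitable orthogonal
coordinates (the axis `e` and its orthogonal hyperplane), the strict subgraph of a Lipschitz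
function. -/
def HasLipschitzBoundary (Ω : Set (E n)) : Prop :=
  ∀ x ∈ frontier Ω, ∃ (e : E n) (g : ↥(Submodule.span ℝ {e})ᗮ → ℝ) (K : ℝ≥0) (U : Set (E n)),
    ‖e‖ = 1 ∧ LipschitzWith K g ∧ IsOpen U ∧ x ∈ U ∧
      ∀ y ∈ U, y ∈ Ω ↔
        inner ℝ e y < g ((Submodule.span ℝ {e})ᗮ.orthogonalProjectionOnto y)

/-- `S` is a Lipschitz hypersurface of the `(n-1)`-dimensional Lipschitz surface `Γ ⊆ ℝⁿ`: near
each point of `S` there is a bi-Lipschitz chart of `Γ` onto an open subset of `ℝⁿ⁻¹` in which `S`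
is a coordinate hyperplane. -/
def IsLipschitzInterface (Γ S : Set (E n)) : Prop :=
  ∀ x ∈ S, ∃ (U : Set (E n)) (φ : E n → E (n - 1)) (K K' : ℝ≥0) (i : Fin (n - 1)),
    IsOpen U ∧ x ∈ U ∧ LipschitzOnWith K φ (U ∩ Γ) ∧
      (∀ y ∈ U ∩ Γ, ∀ z ∈ U ∩ Γ, dist y z ≤ K' * dist (φ y) (φ z)) ∧
      IsOpen (φ '' (U ∩ Γ)) ∧ ∀ y ∈ U ∩ Γ, y ∈ S ↔ φ y i = 0

/-- `Ω ⊆ ℝⁿ` is a bounded connected open set with Lipschitz boundary, and `Γ₀`, `Γ₁` are disjoint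
relatively open subsets of `∂Ω` whose closures cover `∂Ω` and meet along a Lipschitz
interface. Neither `Γ₀` nor `Γ₁` is required to be nonempty. -/
structure IsMixedDomain (Ω Γ₀ Γ₁ : Set (E n)) : Prop where
  isOpen : IsOpen Ω
  isBounded : Bornology.IsBounded Ω
  isConnected : IsConnected Ω
  lipschitz : HasLipschitzBoundary Ω
  relOpen₀ : ∃ U : Set (E n), IsOpen U ∧ Γ₀ = U ∩ frontier Ω
  relOpen₁ : ∃ U : Set (E n), IsOpen U ∧ Γ₁ = U ∩ frontier Ω
  disjoint : Disjoint Γ₀ Γ₁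
  cover : closure Γ₀ ∪ closure Γ₁ = frontier Ω
  interface : IsLipschitzInterface (frontier Ω) (closure Γ₀ ∩ closure Γ₁)

end Domains

section Spaces

variable {n : ℕ}

/-- `H = L²(Ω)`. -/
abbrev H (Ω : Set (E n)) : Type := Lp ℝ 2 (volume.restrict Ω)

/-- `L²(Ω)ⁿ`. -/
abbrev HVec (Ω : Set (E n)) : Type := Lp (E n) 2 (volume.restrict Ω)

/-- `g` is the distributional gradient of `v` in `Ω`:
`∫_Ω v ∂ᵢφ = - ∫_Ω gᵢ φ` for all `φ ∈ C_c^∞(Ω)` and all `i`. -/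
def IsWeakGradient (Ω : Set (E n)) (v : H Ω) (g : HVec Ω) : Prop :=
  ∀ φ : E n → ℝ, IsTestFunction Ω φ → ∀ i : Fin n,
    ∫ x in Ω, v x * fderiv ℝ φ x (EuclideanSpace.single i 1) = - ∫ x in Ω, g x i * φ x

/-- The surface measure of `ℝⁿ` (the Euclidean-normalized `(n-1)`-dimensional Hausdorff measure)
restricted to `S`. -/
noncomputable abbrev surface (S : Set (E n)) : Measure (E n) := μHE[n - 1].restrict S

/-- The pairs `(v, g) ∈ L²(Ω) × L²(Ω)ⁿ` carry the Hilbert product norm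
`‖(v, g)‖² = ‖v‖² + ‖g‖²`; `H¹(Ω)` is viewed in it as the set of the pairs `(v, ∇v)`, so that
it gets its usual inner product. -/
abbrev Pairs (Ω : Set (E n)) : Type := WithLp 2 (H Ω × HVec Ω)

/-- `w ∈ L²(Γ₀)` is the trace on `Γ₀` of `p = (v, ∇v)`: some functions
`φ_k ∈ C^∞(Ω̄)` converge to `v` in `H¹(Ω)` while their restrictions to `Γ₀` converge to `w`
in `L²(Γ₀)`. In other words the trace operator is the closure of the restriction operator. -/
def HasTrace (Ω Γ₀ : Set (E n)) (p : Pairs Ω) (w : Lp ℝ 2 (surface Γ₀)) : Prop :=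
  ∃ φ : ℕ → E n → ℝ, (∀ k, ContDiff ℝ ∞ (φ k)) ∧
    Tendsto (fun k => eLpNorm (fun x => φ k x - p.fst x) 2 (volume.restrict Ω)) atTop (𝓝 0) ∧
    Tendsto (fun k => eLpNorm (fun x => gradient (φ k) x - p.snd x) 2 (volume.restrict Ω))
      atTop (𝓝 0) ∧
    Tendsto (fun k => eLpNorm (fun x => φ k x - w x) 2 (surface Γ₀)) atTop (𝓝 0)

theorem IsTestFunction.memLp {Ω : Set (E n)} {φ : E n → ℝ} (hφ : IsTestFunction Ω φ) :
    MemLp φ 2 (volume.restrict Ω) :=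
  (hφ.contDiff.continuous.memLp_of_hasCompactSupport hφ.hasCompactSupport).restrict Ω

theorem IsTestFunction.memLp_fderiv {Ω : Set (E n)} {φ : E n → ℝ} (hφ : IsTestFunction Ω φ)
    (e : E n) : MemLp (fun x => fderiv ℝ φ x e) 2 (volume.restrict Ω) := by
  have hc : Continuous (fun x => fderiv ℝ φ x e) :=
    (hφ.contDiff.continuous_fderiv (by simp)).clm_apply continuous_const
  exact (hc.memLp_of_hasCompactSupport (hφ.hasCompactSupport.fderiv_apply ℝ e)).restrict Ω

theorem memLp_coord {Ω : Set (E n)} (g : HVec Ω) (i : Fin n) :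
    MemLp (fun x => g x i) 2 (volume.restrict Ω) :=
  ((EuclideanSpace.proj i : E n →L[ℝ] ℝ).comp_memLp' (Lp.memLp g))

theorem IsWeakGradient.zero (Ω : Set (E n)) : IsWeakGradient Ω 0 0 := by
  intro φ _ i
  have h1 : ∫ x in Ω, ((0 : H Ω) x) * fderiv ℝ φ x (EuclideanSpace.single i 1) = 0 := by
    refine integral_eq_zero_of_ae ?_
    filter_upwards [Lp.coeFn_zero ℝ 2 (volume.restrict Ω)] with x hx
    rw [hx]
    simp
  have h2 : ∫ x in Ω, ((0 : HVec Ω) x) i * φ x = 0 := by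
    refine integral_eq_zero_of_ae ?_
    filter_upwards [Lp.coeFn_zero (E n) 2 (volume.restrict Ω)] with x hx
    rw [hx]
    simp
  rw [h1, h2, neg_zero]

theorem IsWeakGradient.add {Ω : Set (E n)} {v v' : H Ω} {g g' : HVec Ω}
    (h : IsWeakGradient Ω v g) (h' : IsWeakGradient Ω v' g') :
    IsWeakGradient Ω (v + v') (g + g') := by
  intro φ hφ i
  have h1 : ∫ x in Ω, (v + v') x * fderiv ℝ φ x (EuclideanSpace.single i 1) =
      (∫ x in Ω, v x * fderiv ℝ φ x (EuclideanSpace.single i 1)) +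
        ∫ x in Ω, v' x * fderiv ℝ φ x (EuclideanSpace.single i 1) := by
    refine Eq.trans (integral_congr_ae ?_)
      (integral_add ((Lp.memLp v).integrable_mul (hφ.memLp_fderiv _))
        ((Lp.memLp v').integrable_mul (hφ.memLp_fderiv _)))
    filter_upwards [Lp.coeFn_add v v'] with x hx
    rw [hx]
    simp [add_mul]
  have h2 : ∫ x in Ω, (g + g') x i * φ x =
      (∫ x in Ω, g x i * φ x) + ∫ x in Ω, g' x i * φ x := by
    refine Eq.trans (integral_congr_ae ?_)
      (integral_add ((memLp_coord g i).integrable_mul hφ.memLp)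
        ((memLp_coord g' i).integrable_mul hφ.memLp))
    filter_upwards [Lp.coeFn_add g g'] with x hx
    rw [hx]
    simp [add_mul]
  rw [h1, h2, h φ hφ i, h' φ hφ i]
  ring

theorem IsWeakGradient.smul {Ω : Set (E n)} {v : H Ω} {g : HVec Ω} (c : ℝ)
    (h : IsWeakGradient Ω v g) : IsWeakGradient Ω (c • v) (c • g) := by
  intro φ hφ i
  have h1 : ∫ x in Ω, (c • v) x * fderiv ℝ φ x (EuclideanSpace.single i 1) =
      c * ∫ x in Ω, v x * fderiv ℝ φ x (EuclideanSpace.single i 1) := by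
    rw [← integral_const_mul]
    refine integral_congr_ae ?_
    filter_upwards [Lp.coeFn_smul c v] with x hx
    simp [hx, mul_assoc]
  have h2 : ∫ x in Ω, (c • g) x i * φ x = c * ∫ x in Ω, g x i * φ x := by
    rw [← integral_const_mul]
    refine integral_congr_ae ?_
    filter_upwards [Lp.coeFn_smul c g] with x hx
    simp [hx, mul_assoc]
  rw [h1, h2, h φ hφ i]
  ring

theorem tendsto_eLpNorm_add {X F : Type*} [MeasurableSpace X] [NormedAddCommGroup F]
    {μ : Measure X} {f g : ℕ → X → F} {f₀ g₀ s₀ : X → F}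
    (hf : ∀ k, AEStronglyMeasurable (fun x => f k x - f₀ x) μ)
    (hg : ∀ k, AEStronglyMeasurable (fun x => g k x - g₀ x) μ)
    (hs : s₀ =ᵐ[μ] fun x => f₀ x + g₀ x)
    (h : Tendsto (fun k => eLpNorm (fun x => f k x - f₀ x) 2 μ) atTop (𝓝 0))
    (h' : Tendsto (fun k => eLpNorm (fun x => g k x - g₀ x) 2 μ) atTop (𝓝 0)) :
    Tendsto (fun k => eLpNorm (fun x => (f k x + g k x) - s₀ x) 2 μ) atTop (𝓝 0) := by
  have hsum := h.add h'
  rw [add_zero] at hsum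
  refine tendsto_of_tendsto_of_tendsto_of_le_of_le tendsto_const_nhds hsum
    (fun _ => zero_le) (fun k => ?_)
  have he : (fun x => (f k x + g k x) - s₀ x) =ᵐ[μ]
      (fun x => f k x - f₀ x) + (fun x => g k x - g₀ x) := by
    filter_upwards [hs] with x hx
    simp only [Pi.add_apply, hx]
    abel
  rw [eLpNorm_congr_ae he]
  exact eLpNorm_add_le (hf k) (hg k) (by norm_num)

theorem tendsto_eLpNorm_smul {X F : Type*} [MeasurableSpace X] [NormedAddCommGroup F]
    [NormedSpace ℝ F] {μ : Measure X} {f : ℕ → X → F} {f₀ s₀ : X → F} (c : ℝ)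
    (hs : s₀ =ᵐ[μ] fun x => c • f₀ x)
    (h : Tendsto (fun k => eLpNorm (fun x => f k x - f₀ x) 2 μ) atTop (𝓝 0)) :
    Tendsto (fun k => eLpNorm (fun x => c • f k x - s₀ x) 2 μ) atTop (𝓝 0) := by
  have hmul := ENNReal.Tendsto.const_mul (a := ‖c‖ₑ) h (Or.inr enorm_ne_top)
  rw [mul_zero] at hmul
  refine hmul.congr (fun k => ?_)
  have he : (fun x => c • f k x - s₀ x) =ᵐ[μ] c • (fun x => f k x - f₀ x) := by
    filter_upwards [hs] with x hx
    simp only [Pi.smul_apply, hx, smul_sub]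
  rw [eLpNorm_congr_ae he, eLpNorm_const_smul]

theorem continuous_gradient {φ : E n → ℝ} (hφ : ContDiff ℝ ∞ φ) : Continuous (gradient φ) :=
  (InnerProductSpace.toDual ℝ (E n)).symm.continuous.comp (hφ.continuous_fderiv (by simp))

theorem HasTrace.zero (Ω Γ₀ : Set (E n)) : HasTrace Ω Γ₀ 0 0 := by
  refine ⟨fun _ _ => 0, fun _ => contDiff_const, ?_, ?_, ?_⟩
  · refine tendsto_const_nhds.congr (fun k => ?_)
    rw [← eLpNorm_zero (ε := ℝ) (p := 2) (μ := volume.restrict Ω)]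
    refine eLpNorm_congr_ae ?_
    filter_upwards [Lp.coeFn_zero ℝ 2 (volume.restrict Ω)] with x hx
    simp only [WithLp.zero_fst, hx]
    simp
  · refine tendsto_const_nhds.congr (fun k => ?_)
    rw [← eLpNorm_zero (ε := E n) (p := 2) (μ := volume.restrict Ω)]
    refine eLpNorm_congr_ae ?_
    filter_upwards [Lp.coeFn_zero (E n) 2 (volume.restrict Ω)] with x hx
    simp only [WithLp.zero_snd, hx]
    simp [gradient]
  · refine tendsto_const_nhds.congr (fun k => ?_)
    rw [← eLpNorm_zero (ε := ℝ) (p := 2) (μ := surface Γ₀)]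
    refine eLpNorm_congr_ae ?_
    filter_upwards [Lp.coeFn_zero ℝ 2 (surface Γ₀)] with x hx
    rw [hx]
    simp

theorem HasTrace.add {Ω Γ₀ : Set (E n)} {p q : Pairs Ω} {w z : Lp ℝ 2 (surface Γ₀)}
    (hp : HasTrace Ω Γ₀ p w) (hq : HasTrace Ω Γ₀ q z) : HasTrace Ω Γ₀ (p + q) (w + z) := by
  obtain ⟨φ, hφ, h1, h2, h3⟩ := hp
  obtain ⟨ρ, hρ, k1, k2, k3⟩ := hq
  refine ⟨fun k x => φ k x + ρ k x, fun k => (hφ k).add (hρ k), ?_, ?_, ?_⟩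
  · exact tendsto_eLpNorm_add
      (fun k => (hφ k).continuous.aestronglyMeasurable.sub (Lp.aestronglyMeasurable _))
      (fun k => (hρ k).continuous.aestronglyMeasurable.sub (Lp.aestronglyMeasurable _))
      (Lp.coeFn_add p.fst q.fst) h1 k1
  · have hg : ∀ k x, gradient (fun x => φ k x + ρ k x) x =
        gradient (φ k) x + gradient (ρ k) x := by
      intro k x
      simp only [gradient]
      rw [fderiv_fun_add ((hφ k).differentiable (by simp) x) ((hρ k).differentiable (by simp) x),
        map_add]
    simp only [hg]
    exact tendsto_eLpNorm_add
      (fun k => (continuous_gradient (hφ k)).aestronglyMeasurable.sub (Lp.aestronglyMeasurable _))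
      (fun k => (continuous_gradient (hρ k)).aestronglyMeasurable.sub (Lp.aestronglyMeasurable _))
      (Lp.coeFn_add p.snd q.snd) h2 k2
  · exact tendsto_eLpNorm_add
      (fun k => (hφ k).continuous.aestronglyMeasurable.sub (Lp.aestronglyMeasurable _))
      (fun k => (hρ k).continuous.aestronglyMeasurable.sub (Lp.aestronglyMeasurable _))
      (Lp.coeFn_add w z) h3 k3

theorem HasTrace.smul {Ω Γ₀ : Set (E n)} {p : Pairs Ω} {w : Lp ℝ 2 (surface Γ₀)} (c : ℝ)
    (hp : HasTrace Ω Γ₀ p w) : HasTrace Ω Γ₀ (c • p) (c • w) := by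
  obtain ⟨φ, hφ, h1, h2, h3⟩ := hp
  refine ⟨fun k x => c • φ k x, fun k => (hφ k).const_smul c, ?_, ?_, ?_⟩
  · exact tendsto_eLpNorm_smul c (Lp.coeFn_smul c p.fst) h1
  · have hg : ∀ k x, gradient (fun x => c • φ k x) x = c • gradient (φ k) x := by
      intro k x
      simp only [gradient]
      rw [fderiv_fun_const_smul ((hφ k).differentiable (by simp) x), map_smul]
    simp only [hg]
    exact tendsto_eLpNorm_smul c (Lp.coeFn_smul c p.snd) h2
  · exact tendsto_eLpNorm_smul c (Lp.coeFn_smul c w) h3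

/-- `H¹(Ω)`, as the space of the pairs `(v, ∇v)`. -/
def H1 (Ω : Set (E n)) : Submodule ℝ (Pairs Ω) where
  carrier := {p | IsWeakGradient Ω p.fst p.snd}
  zero_mem' := IsWeakGradient.zero Ω
  add_mem' hp hq := IsWeakGradient.add hp hq
  smul_mem' c _ hp := IsWeakGradient.smul c hp

/-- `H¹_{Γ₀}(Ω) = {v ∈ H¹(Ω) : v = 0 on Γ₀}`. -/
def H1Γ (Ω Γ₀ : Set (E n)) : Submodule ℝ (Pairs Ω) where
  carrier := {p | p ∈ H1 Ω ∧ HasTrace Ω Γ₀ p 0}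
  zero_mem' := ⟨(H1 Ω).zero_mem, HasTrace.zero Ω Γ₀⟩
  add_mem' hp hq := ⟨(H1 Ω).add_mem hp.1 hq.1, by simpa using hp.2.add hq.2⟩
  smul_mem' c _ hp := ⟨(H1 Ω).smul_mem c hp.1, by simpa using hp.2.smul c⟩

/-- `V = H¹_{Γ₀}(Ω)`, with the inner product `∫_Ω v₁ v₂ + ∫_Ω ∇v₁ · ∇v₂`. -/
abbrev V (Ω Γ₀ : Set (E n)) : Type := ↥(H1Γ Ω Γ₀)

/-- `V'`, the topological dual of `V` with the dual norm. -/
abbrev V' (Ω Γ₀ : Set (E n)) : Type := StrongDual ℝ (V Ω Γ₀)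

/-- The embedding `V ⊂ H`. -/
noncomputable def toH (Ω Γ₀ : Set (E n)) : V Ω Γ₀ →L[ℝ] H Ω :=
  (WithLp.fstL 2 ℝ (H Ω) (HVec Ω)).comp (H1Γ Ω Γ₀).subtypeL

/-- The gradient `∇ : V → L²(Ω)ⁿ`. -/
noncomputable def grad (Ω Γ₀ : Set (E n)) : V Ω Γ₀ →L[ℝ] HVec Ω :=
  (WithLp.sndL 2 ℝ (H Ω) (HVec Ω)).comp (H1Γ Ω Γ₀).subtypeL

/-- The embedding `H ⊂ V'`, `⟨h, v⟩ = (h, v)_H`. -/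
noncomputable def toDual (Ω Γ₀ : Set (E n)) : H Ω →L[ℝ] V' Ω Γ₀ :=
  (ContinuousLinearMap.precomp ℝ (toH Ω Γ₀)).comp (innerSL ℝ : H Ω →L[ℝ] StrongDual ℝ (H Ω))

theorem toDual_apply (Ω Γ₀ : Set (E n)) (h : H Ω) (v : V Ω Γ₀) :
    toDual Ω Γ₀ h v = inner ℝ h (toH Ω Γ₀ v) := rfl

/-- The operator `A : V → V'`, `⟨A v₁, v₂⟩ = ∫_Ω ∇v₁ · ∇v₂`. -/
noncomputable def A (Ω Γ₀ : Set (E n)) : V Ω Γ₀ →L[ℝ] V' Ω Γ₀ :=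
  ((ContinuousLinearMap.precomp ℝ (grad Ω Γ₀)).comp
    (innerSL ℝ : HVec Ω →L[ℝ] StrongDual ℝ (HVec Ω))).comp (grad Ω Γ₀)

theorem A_apply (Ω Γ₀ : Set (E n)) (v₁ v₂ : V Ω Γ₀) :
    A Ω Γ₀ v₁ v₂ = ∫ x in Ω, inner ℝ (grad Ω Γ₀ v₁ x) (grad Ω Γ₀ v₂ x) := rfl

end Spaces

section Time

variable {B : Type*} [NormedAddCommGroup B] [NormedSpace ℝ B]

/-- Lebesgue measure on `]0,T[`. -/
noncomputable abbrev timeMeasure (T : ℝ) : Measure ℝ := volume.restrict (Ioo 0 T)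

/-- `w ∈ H¹(0,T;B)` with distributional derivative `w' ∈ L²(0,T;B)`. -/
structure HasH1Deriv [CompleteSpace B] (T : ℝ) (w w' : ℝ → B) : Prop where
  memLp : MemLp w 2 (timeMeasure T)
  memLp_deriv : MemLp w' 2 (timeMeasure T)
  integral_eq : ∀ φ : ℝ → ℝ, IsTestFunction (Ioo 0 T) φ →
    ∫ t in Ioo 0 T, deriv φ t • w t = - ∫ t in Ioo 0 T, φ t • w' t

/-- `wc : [0,T] → B` is the continuous representative of `w : ]0,T[ → B`. -/
def IsContRep (T : ℝ) (w wc : ℝ → B) : Prop :=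
  ContinuousOn wc (Icc 0 T) ∧ ∀ᵐ t ∂timeMeasure T, wc t = w t

/-- `w(0) = b` in `B`, in the sense of the continuous representative of `w`. -/
def HasInitialValue (T : ℝ) (w : ℝ → B) (b : B) : Prop :=
  ∃ wc : ℝ → B, IsContRep T w wc ∧ wc 0 = b

end Time

section Problem

variable {n : ℕ}

/-- `f = h₁ + h₂` a.e. in `]0,T[`, with `h₁ ∈ L¹(0,T;H)` and `h₂ ∈ L²(0,T;V')`. -/
def IsDecomposition (T : ℝ) (Ω Γ₀ : Set (E n)) (f : ℝ → V' Ω Γ₀)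
    (h₁ : Lp (H Ω) 1 (timeMeasure T)) (h₂ : Lp (V' Ω Γ₀) 2 (timeMeasure T)) : Prop :=
  ∀ᵐ t ∂timeMeasure T, f t = toDual Ω Γ₀ (h₁ t) + h₂ t

/-- `f ∈ L¹(0,T;H) + L²(0,T;V')`. -/
def MemSum (T : ℝ) (Ω Γ₀ : Set (E n)) (f : ℝ → V' Ω Γ₀) : Prop :=
  ∃ h₁ h₂, IsDecomposition T Ω Γ₀ f h₁ h₂

/-- The norm of `L¹(0,T;H) + L²(0,T;V')`. -/
noncomputable def sumNorm (T : ℝ) (Ω Γ₀ : Set (E n)) (f : ℝ → V' Ω Γ₀) : ℝ :=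
  sInf {r : ℝ | ∃ h₁ h₂, IsDecomposition T Ω Γ₀ f h₁ h₂ ∧ r = ‖h₁‖ + ‖h₂‖}

/-- `L²(Q)`, `Q` being the cylinder of the points `(t, x)` with `t ∈ ]0,T[`, `x ∈ Ω`. -/
abbrev L2Q (T : ℝ) (Ω : Set (E n)) : Type :=
  Lp ℝ 2 ((volume : Measure (ℝ × E n)).restrict (Ioo 0 T ×ˢ Ω))

/-- `(θ, χ)` solves the problem with phase relaxation for the data `f`, `u`, `θ₀`, `χ₀`:
`θ ∈ L²(0,T;V) ∩ H¹(0,T;V')`, `χ ∈ H¹(0,T;H)`, `θ' + χ' + A θ = f` in `V'` a.e. in `]0,T[`,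
`ε χ' = ψ(θ + u, χ)` a.e. in `Q`, `θ(0) = θ₀` and `χ(0) = χ₀`. A priori `θ` has a continuous
representative with values in `V'` only, so that `θ(0) = θ₀` is understood in `V'`. -/
def IsSolution (T ε : ℝ) (Ω Γ₀ : Set (E n)) (ψ : EuclideanSpace ℝ (Fin 2) → ℝ)
    (f : ℝ → V' Ω Γ₀) (u : L2Q T Ω) (θ₀ χ₀ : H Ω) (θ : ℝ → V Ω Γ₀) (χ : ℝ → H Ω) : Prop :=
  ∃ (θ' : ℝ → V' Ω Γ₀) (χ' : ℝ → H Ω),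
    MemLp θ 2 (timeMeasure T) ∧
    HasH1Deriv T (fun t => toDual Ω Γ₀ (toH Ω Γ₀ (θ t))) θ' ∧
    HasH1Deriv T χ χ' ∧
    (∀ᵐ t ∂timeMeasure T, θ' t + toDual Ω Γ₀ (χ' t) + A Ω Γ₀ (θ t) = f t) ∧
    (∀ᵐ t ∂timeMeasure T, ∀ᵐ x ∂volume.restrict Ω,
      ε * χ' t x = ψ !₂[toH Ω Γ₀ (θ t) x + u (t, x), χ t x]) ∧
    HasInitialValue T (fun t => toDual Ω Γ₀ (toH Ω Γ₀ (θ t))) (toDual Ω Γ₀ θ₀) ∧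
    HasInitialValue T χ χ₀

end Problem

end StefanRelaxation

open StefanRelaxation

/-! The estimate is an energy argument for the difference `(θ, χ)` of two solutions. Testing the
difference of the first equations with `θ` and pairing `χ'` with `χ` gives the rate of `e = ‖θ‖² +
‖χ‖²`. The gradient term coming from `A` absorbs the `V`-part of the pairing with the `L²(0,T;V')`
component of the source. The relaxation law and the Lipschitz bound on `ψ` control `‖χ'‖²` by
`(L/ε)²` times squares of `θ`, `u` and `χ`. The `L¹(0,T;H)` component contributes `‖h₁‖ √e`, which
is not quadratic in the data. It is bounded through the maximum of `e`, carried through Gronwall,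
and absorbed by Young's inequality (`energy_rate_le`, `le_of_ae_rate_le`).

The delicate point is that `θ'` takes values in `V'` only. The Lions–Magenes lemma
`HasH1Deriv.exists_isContRep` supplies both the continuous `H`-valued representative and the energy
identity. It is proved by mollification: for smooth approximations the identity is the fundamental
theorem of calculus, and applied to differences of approximations it shows that they are uniformly
Cauchy in `H`. Kernels supported on one side of `0` reach one endpoint of the interval without
extending the function across it; two such constructions are glued.

The initial value of `θ` is prescribed in `V'`. It transfers to `H` because `H → V'` is injective:
test functions lie in `V`. Uniqueness at the level of `V` uses in addition that an element of `H¹`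
is determined by its function part. -/

section Mollify

/-! ### Mollification in `L²(ℝ; B)` -/

open scoped Convolution

variable {B : Type*} [NormedAddCommGroup B]

theorem tendsto_eLpNorm_translate_sub {f : ℝ → B} (hf : MemLp f 2 volume) :
    Tendsto (fun s : ℝ => eLpNorm (fun t => f (t - s) - f t) 2 volume) (𝓝 0) (𝓝 0) := by
  let g : ℝ → C(ℝ, ℝ) := fun s => ⟨fun t => t - s, by fun_prop⟩
  have hg : Continuous g := by
    have : Continuous (Function.uncurry fun s t : ℝ => t - s) := by
      unfold Function.uncurry; fun_prop
    exact (ContinuousMap.curry ⟨_, this⟩).continuous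
  have hgm : ∀ s, MeasurePreserving (g s) volume volume := fun s =>
    measurePreserving_sub_right volume s
  have key := (Continuous.compMeasurePreservingLp (f := fun _ : ℝ => hf.toLp f) (p := 2)
    continuous_const hg hgm (by norm_num)).tendsto 0
  rw [Lp.tendsto_Lp_iff_tendsto_eLpNorm'] at key
  refine key.congr fun s => eLpNorm_congr_ae ?_
  have h1 := Lp.coeFn_compMeasurePreserving (hf.toLp f) (hgm s)
  have h0 := Lp.coeFn_compMeasurePreserving (hf.toLp f) (hgm 0)
  have h2 := (hgm s).quasiMeasurePreserving.ae_eq_comp hf.coeFn_toLp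
  have h3 := (hgm 0).quasiMeasurePreserving.ae_eq_comp hf.coeFn_toLp
  filter_upwards [h0, h1, h2, h3] with t a b c d
  simp only [Pi.sub_apply]
  rw [a, b, c, d]
  simp [g]

/-- Cauchy–Schwarz against the constant `1`. -/
theorem lintegral_sq_le_of_isProbabilityMeasure {X : Type*} [MeasurableSpace X] {ν : Measure X}
    [IsProbabilityMeasure ν] {g : X → ℝ≥0∞} (hg : AEMeasurable g ν) :
    (∫⁻ x, g x ∂ν) ^ (2 : ℝ) ≤ ∫⁻ x, g x ^ (2 : ℝ) ∂ν := by
  have h := ENNReal.lintegral_mul_le_Lp_mul_Lq ν Real.HolderConjugate.two_two hg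
    (aemeasurable_const (b := (1 : ℝ≥0∞)))
  simp only [Pi.mul_apply, mul_one, ENNReal.one_rpow, lintegral_const, measure_univ] at h
  have h' := ENNReal.rpow_le_rpow h (by norm_num : (0 : ℝ) ≤ 2)
  rwa [← ENNReal.rpow_mul, show (1 / 2 : ℝ) * 2 = 1 by norm_num, ENNReal.rpow_one] at h'

theorem eLpNorm_two_rpow {X : Type*} [MeasurableSpace X] {ν : Measure X} (f : X → B) :
    eLpNorm f 2 ν ^ (2 : ℝ) = ∫⁻ x, ‖f x‖ₑ ^ (2 : ℝ) ∂ν := by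
  have := eLpNorm_nnreal_pow_eq_lintegral (f := f) (μ := ν) (p := 2) (by norm_num)
  simpa using this

variable [NormedSpace ℝ B]

/-- Since `ρ` has integral one, the error at `t` is the average of `f (t - s) - f t` under the
probability measure with density `ρ`. Jensen's inequality for the square and an exchange of
integrals reduce it to the translation errors, needed only for `s` in the support. -/
theorem eLpNorm_convolution_sub_le [CompleteSpace B] {f : ℝ → B} (hf : MemLp f 2 volume)
    {ρ : ℝ → ℝ} (hρc : Continuous ρ) (hρs : HasCompactSupport ρ) (hρ0 : ∀ x, 0 ≤ ρ x)
    (hρ1 : ∫ x, ρ x = 1) {C : ℝ≥0∞}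
    (hC : ∀ s ∈ Function.support ρ, eLpNorm (fun t => f (t - s) - f t) 2 volume ≤ C) :
    eLpNorm (fun t => (ρ ⋆[ContinuousLinearMap.lsmul ℝ ℝ, volume] f) t - f t) 2 volume ≤ C := by
  have hρi : Integrable ρ := hρc.integrable_of_hasCompactSupport hρs
  have hloc : LocallyIntegrable f volume := hf.locallyIntegrable (by norm_num)
  let ν : Measure ℝ := volume.withDensity fun s => ENNReal.ofReal (ρ s)
  have hρm : Measurable fun s => ENNReal.ofReal (ρ s) := hρc.measurable.ennreal_ofReal
  have hν : IsProbabilityMeasure ν := by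
    constructor
    rw [withDensity_apply _ MeasurableSet.univ, Measure.restrict_univ,
      ← ofReal_integral_eq_lintegral_ofReal hρi (ae_of_all _ hρ0), hρ1, ENNReal.ofReal_one]
  have hνac : ν ≪ volume := withDensity_absolutelyContinuous _ _
  have hsub : Measure.QuasiMeasurePreserving (fun p : ℝ × ℝ => p.1 - p.2) (volume.prod volume) volume :=
    quasiMeasurePreserving_sub volume volume
  have hF : AEStronglyMeasurable (fun p : ℝ × ℝ => f (p.1 - p.2) - f p.1)
      ((volume : Measure ℝ).prod ν) := by
    refine AEStronglyMeasurable.mono_ac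
      (Measure.AbsolutelyContinuous.prod Measure.AbsolutelyContinuous.rfl hνac) ?_
    exact (hf.1.comp_quasiMeasurePreserving hsub).sub hf.1.comp_fst
  have hpt : ∀ᵐ t, ‖(ρ ⋆[ContinuousLinearMap.lsmul ℝ ℝ, volume] f) t - f t‖ₑ ^ (2 : ℝ) ≤
      ∫⁻ s, ‖f (t - s) - f t‖ₑ ^ (2 : ℝ) ∂ν := by
    filter_upwards [hF.prodMk_left] with t ht
    have hconv : Integrable (fun s => ρ s • f (t - s)) :=
      hρs.convolutionExists_left (ContinuousLinearMap.lsmul ℝ ℝ) hρc hloc t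
    have e1 : (ρ ⋆[ContinuousLinearMap.lsmul ℝ ℝ, volume] f) t - f t =
        ∫ s, ρ s • (f (t - s) - f t) := by
      simp only [smul_sub]
      rw [integral_sub hconv (hρi.smul_const _), integral_smul_const, hρ1, one_smul]
      rfl
    have e2 : ‖(ρ ⋆[ContinuousLinearMap.lsmul ℝ ℝ, volume] f) t - f t‖ₑ ≤
        ∫⁻ s, ‖f (t - s) - f t‖ₑ ∂ν := by
      rw [e1]
      refine (enorm_integral_le_lintegral_enorm _).trans (le_of_eq ?_)
      rw [lintegral_withDensity_eq_lintegral_mul_non_measurable _ hρm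
        (ae_of_all _ fun _ => ENNReal.ofReal_lt_top)]
      refine lintegral_congr fun s => ?_
      rw [enorm_smul, Real.enorm_of_nonneg (hρ0 s)]
      rfl
    exact (ENNReal.rpow_le_rpow e2 (by norm_num)).trans
      (lintegral_sq_le_of_isProbabilityMeasure ht.enorm)
  have hmain : eLpNorm (fun t => (ρ ⋆[ContinuousLinearMap.lsmul ℝ ℝ, volume] f) t - f t) 2 volume
      ^ (2 : ℝ) ≤ C ^ (2 : ℝ) := by
    rw [eLpNorm_two_rpow]
    calc _ ≤ ∫⁻ t, (∫⁻ s, ‖f (t - s) - f t‖ₑ ^ (2 : ℝ) ∂ν) := lintegral_mono_ae hpt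
      _ = ∫⁻ s, (∫⁻ t, ‖f (t - s) - f t‖ₑ ^ (2 : ℝ)) ∂ν :=
        lintegral_lintegral_swap (hF.enorm.pow_const _)
      _ ≤ ∫⁻ _s, C ^ (2 : ℝ) ∂ν := by
        refine lintegral_mono_ae ?_
        refine (ae_withDensity_iff hρm).2 (ae_of_all _ fun s hs => ?_)
        rw [← eLpNorm_two_rpow]
        refine ENNReal.rpow_le_rpow (hC s fun h0 => hs ?_) (by norm_num)
        rw [h0, ENNReal.ofReal_zero]
      _ = C ^ (2 : ℝ) := by simp
  exact (ENNReal.rpow_le_rpow_iff (by norm_num : (0 : ℝ) < 2)).1 hmain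

/-- Translation preserves the `L²` norm, so the preceding bound applies with `C = 2‖f‖`, and the
convolution is `f` plus an `L²` error. -/
theorem memLp_convolution [CompleteSpace B] {f : ℝ → B} (hf : MemLp f 2 volume)
    {ρ : ℝ → ℝ} (hρc : Continuous ρ) (hρs : HasCompactSupport ρ) (hρ0 : ∀ x, 0 ≤ ρ x)
    (hρ1 : ∫ x, ρ x = 1) :
    MemLp (ρ ⋆[ContinuousLinearMap.lsmul ℝ ℝ, volume] f) 2 volume := by
  have hc : Continuous (ρ ⋆[ContinuousLinearMap.lsmul ℝ ℝ, volume] f) :=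
    hρs.continuous_convolution_left _ hρc (hf.locallyIntegrable (by norm_num))
  have hd : MemLp (fun t => (ρ ⋆[ContinuousLinearMap.lsmul ℝ ℝ, volume] f) t - f t) 2 volume := by
    refine ⟨hc.aestronglyMeasurable.sub hf.1,
      (eLpNorm_convolution_sub_le hf hρc hρs hρ0 hρ1 (C := eLpNorm f 2 volume + eLpNorm f 2 volume)
        fun s _ => ?_).trans_lt (ENNReal.add_lt_top.2 ⟨hf.2, hf.2⟩)⟩
    have hs := measurePreserving_sub_right (volume : Measure ℝ) s
    have h := eLpNorm_sub_le (hf.1.comp_measurePreserving hs) hf.1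
      (by norm_num : (1 : ℝ≥0∞) ≤ 2)
    rwa [eLpNorm_comp_measurePreserving hf.1 hs] at h
  have := hd.add hf
  simpa [Pi.add_def] using this

theorem tendsto_eLpNorm_convolution_sub [CompleteSpace B] {f : ℝ → B} (hf : MemLp f 2 volume)
    {ρ : ℕ → ℝ → ℝ} (hρc : ∀ k, Continuous (ρ k)) (hρs : ∀ k, HasCompactSupport (ρ k))
    (hρ0 : ∀ k x, 0 ≤ ρ k x) (hρ1 : ∀ k, ∫ x, ρ k x = 1)
    (hρt : Tendsto (fun k => Function.support (ρ k)) atTop (𝓝 0).smallSets) :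
    Tendsto (fun k => eLpNorm
      (fun t => (ρ k ⋆[ContinuousLinearMap.lsmul ℝ ℝ, volume] f) t - f t) 2 volume)
      atTop (𝓝 0) := by
  rw [ENNReal.tendsto_nhds_zero]
  intro C hC
  have h := (ENNReal.tendsto_nhds_zero.1 (tendsto_eLpNorm_translate_sub hf)) C hC
  filter_upwards [hρt.eventually (eventually_smallSets.2 ⟨_, h, fun _ ht => ht⟩)] with k hk
  exact eLpNorm_convolution_sub_le hf (hρc k) (hρs k) (hρ0 k) (hρ1 k) fun s hs => hk hs

/-- The interval need not contain `0`: kernels supported in `]-δ, 0[` or `]0, δ[` are the ones used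
later. -/
theorem exists_mollifier {a b : ℝ} (hab : a < b) :
    ∃ ρ : ℝ → ℝ, ContDiff ℝ ∞ ρ ∧ HasCompactSupport ρ ∧ (∀ x, 0 ≤ ρ x) ∧ ∫ x, ρ x = 1 ∧
      tsupport ρ ⊆ Ioo a b := by
  let f : ContDiffBump ((a + b) / 2) := ⟨(b - a) / 6, (b - a) / 3, by linarith, by linarith⟩
  refine ⟨f.normed volume, f.contDiff_normed, f.hasCompactSupport_normed, f.nonneg_normed,
    f.integral_normed, ?_⟩
  rw [f.tsupport_normed_eq]
  intro x hx
  rw [Metric.mem_closedBall, Real.dist_eq, abs_le] at hx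
  have : f.rOut = (b - a) / 3 := rfl
  rw [this] at hx
  constructor <;> linarith [hx.1, hx.2]

end Mollify

/-! ### Energy identities in a Gelfand triple: smooth case and passage to the limit -/

section GelfandTriple

open scoped Convolution

variable {W K : Type*} [NormedAddCommGroup W] [NormedSpace ℝ W]
  [NormedAddCommGroup K] [InnerProductSpace ℝ K]

theorem MeasureTheory.MemLp.integrable_dual_apply {X : Type*} [MeasurableSpace X] {μ : Measure X}
    {g : X → StrongDual ℝ W} {x : X → W} (hg : MemLp g 2 μ) (hx : MemLp x 2 μ) :
    Integrable (fun t => g t (x t)) μ :=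
  memLp_one_iff_integrable.1
    ((ContinuousLinearMap.id ℝ (StrongDual ℝ W)).memLp_of_bilin (r := 1) hg hx)

theorem abs_intervalIntegral_dual_apply_le {g : ℝ → StrongDual ℝ W} {x : ℝ → W}
    (hg : MemLp g 2 volume) (hx : MemLp x 2 volume) (s t : ℝ) :
    |∫ r in s..t, g r (x r)| ≤ (eLpNorm g 2 volume).toReal * (eLpNorm x 2 volume).toReal := by
  have h1 : |∫ r in s..t, g r (x r)| ≤ ∫ r, ‖g r (x r)‖ := by
    rw [← Real.norm_eq_abs]
    exact intervalIntegral.norm_integral_le_integral_norm_uIoc.trans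
      (setIntegral_le_integral (hg.integrable_dual_apply hx).norm
        (ae_of_all _ fun _ => norm_nonneg _))
  have h2 := eLpNorm_le_eLpNorm_mul_eLpNorm'_of_norm (p := 2) (q := 2) (r := 1) hg.1 hx.1
    (fun (a : StrongDual ℝ W) (b : W) => a b) 1
    (ae_of_all _ fun r => by simpa using (g r).le_opNorm (x r))
  rw [ENNReal.coe_one, one_mul] at h2
  refine h1.trans ?_
  rw [← ENNReal.toReal_mul, integral_norm_eq_lintegral_enorm (hg.integrable_dual_apply hx).1,
    ← eLpNorm_one_eq_lintegral_enorm]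
  exact ENNReal.toReal_mono (ENNReal.mul_ne_top hg.2.ne hx.2.ne) h2

/-- The derivative of `‖i x‖²` is `2 (i x, i x')`, and this is `2 D (i x') x = 2 g x`; only then
does the dual-valued `g` enter. -/
theorem norm_sq_sub_norm_sq_eq_integral (i : W →L[ℝ] K) (D : K →L[ℝ] StrongDual ℝ W)
    (hD : ∀ h v, D h v = inner ℝ h (i v)) {x x' : ℝ → W} {g : ℝ → StrongDual ℝ W} {s t : ℝ}
    (hx : ∀ r ∈ uIcc s t, HasDerivAt x (x' r) r) (hg : Continuous g)
    (hxg : ∀ r ∈ uIcc s t, D (i (x' r)) = g r) :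
    ‖i (x t)‖ ^ 2 - ‖i (x s)‖ ^ 2 = 2 * ∫ r in s..t, g r (x r) := by
  have hxc : ContinuousOn x (uIcc s t) := fun r hr => (hx r hr).continuousAt.continuousWithinAt
  rw [← intervalIntegral.integral_const_mul]
  refine (intervalIntegral.integral_eq_sub_of_hasDerivAt (f := fun r => ‖i (x r)‖ ^ 2)
    (fun r hr => ?_) ?_).symm
  · have h := (i.hasFDerivAt.comp_hasDerivAt r (hx r hr)).norm_sq
    rw [← hxg r hr, hD, real_inner_comm]
    exact h
  · exact (continuousOn_const.mul (hg.continuousOn.clm_apply hxc)).intervalIntegrable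

theorem eLpNorm_toReal_sub_le {B : Type*} [NormedAddCommGroup B] {f g h : ℝ → B}
    (hf : MemLp f 2 volume) (hg : MemLp g 2 volume) (hh : MemLp h 2 volume) :
    (eLpNorm (f - g) 2 volume).toReal ≤
      (eLpNorm (f - h) 2 volume).toReal + (eLpNorm (g - h) 2 volume).toReal := by
  have e : f - g = (f - h) - (g - h) := by abel
  rw [← ENNReal.toReal_add (hf.sub hh).2.ne (hg.sub hh).2.ne, e]
  exact ENNReal.toReal_mono (ENNReal.add_ne_top.2 ⟨(hf.sub hh).2.ne, (hg.sub hh).2.ne⟩)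
    (eLpNorm_sub_le (hf.sub hh).1 (hg.sub hh).1 (by norm_num))

/-- The passage to the limit in the energy identity of a Gelfand triple. -/
theorem exists_continuousOn_of_energy_approx [CompleteSpace K] (i : W →L[ℝ] K)
    {a b : ℝ} (hab : a < b) {x : ℝ → W} {g : ℝ → StrongDual ℝ W}
    {xk : ℕ → ℝ → W} {gk : ℕ → ℝ → StrongDual ℝ W}
    (hx : MemLp x 2 volume) (hg : MemLp g 2 volume)
    (hxk : ∀ k, MemLp (xk k) 2 volume) (hgk : ∀ k, MemLp (gk k) 2 volume)
    (hxc : ∀ k, Continuous (xk k))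
    (hxl : Tendsto (fun k => eLpNorm (xk k - x) 2 volume) atTop (𝓝 0))
    (hgl : Tendsto (fun k => eLpNorm (gk k - g) 2 volume) atTop (𝓝 0))
    (hen : ∀ k l, ∀ s ∈ Icc a b, ∀ t ∈ Icc a b, ‖i (xk k t - xk l t)‖ ^ 2 -
      ‖i (xk k s - xk l s)‖ ^ 2 = 2 * ∫ r in s..t, (gk k r - gk l r) (xk k r - xk l r))
    (hen1 : ∀ k, ∀ s ∈ Icc a b, ∀ t ∈ Icc a b, ‖i (xk k t)‖ ^ 2 -
      ‖i (xk k s)‖ ^ 2 = 2 * ∫ r in s..t, gk k r (xk k r)) :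
    ∃ xc : ℝ → K, ContinuousOn xc (Icc a b) ∧ (∀ᵐ t, t ∈ Icc a b → xc t = i (x t)) ∧
      ∀ s ∈ Icc a b, ∀ t ∈ Icc a b, ‖xc t‖ ^ 2 - ‖xc s‖ ^ 2 = 2 * ∫ r in s..t, g r (x r) := by
  obtain ⟨φ, hφ, hae⟩ := (tendstoInMeasure_of_tendsto_eLpNorm (by norm_num)
    (fun k => (hxk k).1) hx.1 hxl).exists_seq_tendsto_ae
  -- Some point of the interval has pointwise convergence, because the interval has positive
  -- measure. It anchors the energy identity of the differences.
  obtain ⟨s₀, hs₀, hs₀l⟩ : ∃ s₀ ∈ Icc a b, Tendsto (fun k => xk (φ k) s₀) atTop (𝓝 (x s₀)) := by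
    by_contra! hcon
    have h0 : volume (Icc a b) = 0 := by
      refine measure_mono_null (fun s hs => ?_) hae
      exact hcon s hs
    rw [Real.volume_Icc, ENNReal.ofReal_eq_zero] at h0
    linarith
  have hxr : Tendsto (fun k => (eLpNorm (xk (φ k) - x) 2 volume).toReal) atTop (𝓝 0) := by
    have := (ENNReal.tendsto_toReal ENNReal.zero_ne_top).comp (hxl.comp hφ.tendsto_atTop)
    simpa [Function.comp_def] using this
  have hgr : Tendsto (fun k => (eLpNorm (gk (φ k) - g) 2 volume).toReal) atTop (𝓝 0) := by
    have := (ENNReal.tendsto_toReal ENNReal.zero_ne_top).comp (hgl.comp hφ.tendsto_atTop)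
    simpa [Function.comp_def] using this
  have har : Tendsto (fun k => ‖i (xk (φ k) s₀) - i (x s₀)‖) atTop (𝓝 0) :=
    tendsto_iff_norm_sub_tendsto_zero.1 ((i.continuous.tendsto _).comp hs₀l)
  set X : ℕ → ℝ := fun k => (eLpNorm (xk (φ k) - x) 2 volume).toReal with hX
  set Γ : ℕ → ℝ := fun k => (eLpNorm (gk (φ k) - g) 2 volume).toReal with hΓ
  set α : ℕ → ℝ := fun k => ‖i (xk (φ k) s₀) - i (x s₀)‖ with hα
  have hX0 : ∀ k, 0 ≤ X k := fun k => ENNReal.toReal_nonneg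
  have hΓ0 : ∀ k, 0 ≤ Γ k := fun k => ENNReal.toReal_nonneg
  have hα0 : ∀ k, 0 ≤ α k := fun k => norm_nonneg _
  -- The energy identity from `s₀` bounds the squared distance by `(α k + α l)² + 2 (Γ k + Γ l)(X k
  -- + X l)`, uniformly in `t`. All terms are nonnegative, so this is below the square of the
  -- right-hand side.
  have hbound : ∀ k l, ∀ t ∈ Icc a b, dist (i (xk (φ k) t)) (i (xk (φ l) t)) ≤
      2 * ((α k + X k + Γ k) + (α l + X l + Γ l)) := by
    intro k l t ht
    have h1 := hen (φ k) (φ l) s₀ hs₀ t ht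
    have h2 := abs_intervalIntegral_dual_apply_le ((hgk (φ k)).sub (hgk (φ l)))
      ((hxk (φ k)).sub (hxk (φ l))) s₀ t
    have h3 := eLpNorm_toReal_sub_le (hgk (φ k)) (hgk (φ l)) hg
    have h4 := eLpNorm_toReal_sub_le (hxk (φ k)) (hxk (φ l)) hx
    have h5 : ‖i (xk (φ k) s₀ - xk (φ l) s₀)‖ ≤ α k + α l := by
      rw [map_sub, ← sub_sub_sub_cancel_right _ _ (i (x s₀))]
      exact norm_sub_le _ _
    have h6 : |∫ r in s₀..t, (gk (φ k) - gk (φ l)) r ((xk (φ k) - xk (φ l)) r)| ≤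
        (Γ k + Γ l) * (X k + X l) :=
      h2.trans (mul_le_mul h3 h4 ENNReal.toReal_nonneg (add_nonneg (hΓ0 k) (hΓ0 l)))
    have h7 := (abs_le.1 h6).2
    simp only [Pi.sub_apply] at h7
    rw [dist_eq_norm, ← map_sub]
    refine abs_le_of_sq_le_sq' ?_ ?_ |>.2
    · have h8 : ‖i (xk (φ k) s₀ - xk (φ l) s₀)‖ ^ 2 ≤ (α k + α l) ^ 2 := by gcongr
      have e : ‖i (xk (φ k) t - xk (φ l) t)‖ ^ 2 ≤
          (α k + α l) ^ 2 + 2 * ((Γ k + Γ l) * (X k + X l)) := by linarith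
      have p1 := add_nonneg (hα0 k) (hα0 l)
      have p2 := add_nonneg (hΓ0 k) (hΓ0 l)
      have p3 := add_nonneg (hX0 k) (hX0 l)
      nlinarith [mul_nonneg p1 p2, mul_nonneg p1 p3, mul_nonneg p2 p3]
    · have := hα0 k; have := hα0 l; have := hX0 k; have := hX0 l; have := hΓ0 k; have := hΓ0 l
      positivity
  have hS : Tendsto (fun k => α k + X k + Γ k) atTop (𝓝 0) := by
    simpa using (har.add hxr).add hgr
  have hcau : UniformCauchySeqOn (fun k t => i (xk (φ k) t)) atTop (Icc a b) := by
    rw [Metric.uniformCauchySeqOn_iff]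
    intro ε hε
    obtain ⟨N, hN⟩ := eventually_atTop.1 (hS.eventually (gt_mem_nhds (by positivity : 0 < ε / 4)))
    refine ⟨N, fun m hm n hn t ht => (hbound m n t ht).trans_lt ?_⟩
    linarith [hN m hm, hN n hn]
  have hlim : ∀ t ∈ Icc a b, ∃ y, Tendsto (fun k => i (xk (φ k) t)) atTop (𝓝 y) := fun t ht =>
    cauchySeq_tendsto_of_complete (hcau.cauchySeq ht)
  choose! xc hxcl using hlim
  have hunif := hcau.tendstoUniformlyOn_of_tendsto hxcl
  refine ⟨xc, hunif.continuousOn (Frequently.of_forall fun k =>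
    (i.continuous.comp (hxc (φ k))).continuousOn), ?_, fun s hs t ht => ?_⟩
  · filter_upwards [hae] with t ht hmem
    exact tendsto_nhds_unique (hxcl t hmem) ((i.continuous.tendsto _).comp ht)
  · have hI : Tendsto (fun k => ∫ r in s..t, gk (φ k) r (xk (φ k) r)) atTop
        (𝓝 (∫ r in s..t, g r (x r))) := by
      rw [tendsto_iff_norm_sub_tendsto_zero]
      set n₁ := (eLpNorm g 2 volume).toReal
      set n₂ := (eLpNorm x 2 volume).toReal
      have hz : Tendsto (fun k => Γ k * X k + Γ k * n₂ + n₁ * X k) atTop (𝓝 0) := by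
        simpa using ((hgr.mul hxr).add (hgr.mul_const n₂)).add (hxr.const_mul n₁)
      refine squeeze_zero (fun _ => norm_nonneg _) (fun k => ?_) hz
      have hgd := (hgk (φ k)).sub hg
      have hxd := (hxk (φ k)).sub hx
      -- Bilinear expansion around the limit: every term contains at least one factor tending to
      -- zero in `L²`.
      have e : (∫ r in s..t, gk (φ k) r (xk (φ k) r)) - ∫ r in s..t, g r (x r) =
          ((∫ r in s..t, (gk (φ k) - g) r ((xk (φ k) - x) r)) +
            ∫ r in s..t, (gk (φ k) - g) r (x r)) + ∫ r in s..t, g r ((xk (φ k) - x) r) := by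
        have i12 : IntervalIntegrable (fun r => (gk (φ k) - g) r ((xk (φ k) - x) r) +
            (gk (φ k) - g) r (x r)) volume s t :=
          ((hgd.integrable_dual_apply hxd).add (hgd.integrable_dual_apply hx)).intervalIntegrable
        rw [← intervalIntegral.integral_add (hgd.integrable_dual_apply hxd).intervalIntegrable
            (hgd.integrable_dual_apply hx).intervalIntegrable,
          ← intervalIntegral.integral_add i12
            (hg.integrable_dual_apply hxd).intervalIntegrable,
          ← intervalIntegral.integral_sub
            ((hgk (φ k)).integrable_dual_apply (hxk (φ k))).intervalIntegrable
            (hg.integrable_dual_apply hx).intervalIntegrable]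
        refine intervalIntegral.integral_congr fun r _ => ?_
        simp only [Pi.sub_apply, sub_apply, map_sub]
        ring
      rw [e]
      refine (norm_add₃_le).trans (add_le_add (add_le_add ?_ ?_) ?_)
      · exact abs_intervalIntegral_dual_apply_le hgd hxd s t
      · exact abs_intervalIntegral_dual_apply_le hgd hx s t
      · exact abs_intervalIntegral_dual_apply_le hg hxd s t
    refine tendsto_nhds_unique (((hxcl t ht).norm.pow 2).sub ((hxcl s hs).norm.pow 2)) ?_
    refine (hI.const_mul 2).congr fun k => (hen1 (φ k) s hs t ht).symm

end GelfandTriple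

/-! ### The Lions–Magenes lemma -/

section GelfandTriple

open scoped Convolution

variable {W K : Type*} [NormedAddCommGroup W] [NormedSpace ℝ W] [CompleteSpace W]
  [NormedAddCommGroup K] [InnerProductSpace ℝ K]

theorem memLp_indicator_Ioo {B : Type*} [NormedAddCommGroup B] {T : ℝ} {f : ℝ → B}
    (hf : MemLp f 2 (timeMeasure T)) : MemLp ((Ioo 0 T).indicator f) 2 volume :=
  (memLp_indicator_iff_restrict measurableSet_Ioo).2 hf

theorem isTestFunction_comp_sub {ρ : ℝ → ℝ} (hρ : ContDiff ℝ ∞ ρ) (hρs : HasCompactSupport ρ)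
    {T α β t : ℝ} (hsub : tsupport ρ ⊆ Ioo α β) (ht : ∀ s ∈ Ioo α β, t - s ∈ Ioo 0 T) :
    IsTestFunction (Ioo 0 T) (fun r => ρ (t - r)) := by
  have hts : tsupport (fun r => ρ (t - r)) = (fun r => t - r) ⁻¹' tsupport ρ :=
    tsupport_comp_eq_preimage ρ (Homeomorph.subLeft t)
  refine ⟨hρ.comp (contDiff_const.sub contDiff_id),
    hρs.comp_homeomorph (Homeomorph.subLeft t), ?_⟩
  rw [hts]
  intro r hr
  have := ht _ (hsub hr)
  simpa using this

/-- The reflected kernel `r ↦ ρ (t - r)` is an admissible test function as long as its support stays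
inside `]0,T[`. For such `t` the jumps of the zero extension at `0` and `T` are not seen, and the
distributional identity is exactly the claim. -/
theorem StefanRelaxation.HasH1Deriv.convolution_deriv {T : ℝ} (i : W →L[ℝ] K) (D : K →L[ℝ] StrongDual ℝ W)
    {w : ℝ → W} {g : ℝ → StrongDual ℝ W} (hw : MemLp w 2 (timeMeasure T))
    (hd : HasH1Deriv T (fun t => D (i (w t))) g)
    {ρ : ℝ → ℝ} (hρ : ContDiff ℝ ∞ ρ) (hρs : HasCompactSupport ρ) {α β t : ℝ}
    (hsub : tsupport ρ ⊆ Ioo α β) (ht : ∀ s ∈ Ioo α β, t - s ∈ Ioo 0 T) :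
    D (i ((deriv ρ ⋆[ContinuousLinearMap.lsmul ℝ ℝ, volume] (Ioo 0 T).indicator w) t)) =
      (ρ ⋆[ContinuousLinearMap.lsmul ℝ ℝ, volume] (Ioo 0 T).indicator g) t := by
  have hloc : LocallyIntegrable ((Ioo 0 T).indicator w) volume :=
    (memLp_indicator_Ioo hw).locallyIntegrable (by norm_num)
  have hint : Integrable (fun r => deriv ρ (t - r) • (Ioo 0 T).indicator w r) := by
    have h := (hρs.deriv.convolutionExists_left (ContinuousLinearMap.lsmul ℝ ℝ)
      (hρ.continuous_deriv (by simp)) hloc t).integrable_swap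
    simpa using h
  have htest := isTestFunction_comp_sub hρ hρs hsub ht
  have h1 := hd.integral_eq _ htest
  have hderiv : ∀ r, deriv (fun r => ρ (t - r)) r = - deriv ρ (t - r) := fun r =>
    deriv_comp_const_sub ρ t r
  rw [convolution_lsmul_swap, convolution_lsmul_swap, ← ContinuousLinearMap.comp_apply,
    ← ContinuousLinearMap.integral_comp_comm _ hint]
  have e1 : ∀ r, (D.comp i) (deriv ρ (t - r) • (Ioo 0 T).indicator w r) =
      (Ioo 0 T).indicator (fun r => deriv ρ (t - r) • D (i (w r))) r := by
    intro r
    by_cases hr : r ∈ Ioo 0 T <;> simp [hr]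
  have e2 : ∀ r, ρ (t - r) • (Ioo 0 T).indicator g r =
      (Ioo 0 T).indicator (fun r => ρ (t - r) • g r) r := by
    intro r
    by_cases hr : r ∈ Ioo 0 T <;> simp [hr]
  simp only [e1, e2]
  rw [integral_indicator measurableSet_Ioo, integral_indicator measurableSet_Ioo]
  simp only [hderiv, neg_smul] at h1
  rw [integral_neg, neg_inj] at h1
  exact h1

variable [CompleteSpace K]

/-- The window `]α k, β k[` shrinks to `0` but need not surround it. This is what allows `[a,b]` to
contain an endpoint of `[0,T]`. -/
theorem StefanRelaxation.HasH1Deriv.exists_continuousOn_Icc {T : ℝ} (i : W →L[ℝ] K)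
    (D : K →L[ℝ] StrongDual ℝ W) (hD : ∀ h v, D h v = inner ℝ h (i v))
    {w : ℝ → W} {g : ℝ → StrongDual ℝ W} (hw : MemLp w 2 (timeMeasure T))
    (hd : HasH1Deriv T (fun t => D (i (w t))) g) {a b : ℝ} (hab : a < b)
    {α β : ℕ → ℝ} (hαβ : ∀ k, α k < β k) (hα : Tendsto α atTop (𝓝 0))
    (hβ : Tendsto β atTop (𝓝 0))
    (hsub : ∀ k, ∀ t ∈ Icc a b, ∀ s ∈ Ioo (α k) (β k), t - s ∈ Ioo 0 T) :
    ∃ wc : ℝ → K, ContinuousOn wc (Icc a b) ∧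
      (∀ᵐ t, t ∈ Icc a b → wc t = i ((Ioo 0 T).indicator w t)) ∧
      ∀ s ∈ Icc a b, ∀ t ∈ Icc a b, ‖wc t‖ ^ 2 - ‖wc s‖ ^ 2 =
        2 * ∫ r in s..t, (Ioo 0 T).indicator g r ((Ioo 0 T).indicator w r) := by
  choose ρ hρ hρs hρ0 hρ1 hρt using fun k => exists_mollifier (hαβ k)
  have hmw := memLp_indicator_Ioo hw
  have hmg := memLp_indicator_Ioo hd.memLp_deriv
  have hlw : LocallyIntegrable ((Ioo 0 T).indicator w) volume :=
    hmw.locallyIntegrable (by norm_num)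
  have hlg : LocallyIntegrable ((Ioo 0 T).indicator g) volume :=
    hmg.locallyIntegrable (by norm_num)
  have hρc : ∀ k, Continuous (ρ k) := fun k => (hρ k).continuous
  have hρsmall : Tendsto (fun k => Function.support (ρ k)) atTop (𝓝 0).smallSets := by
    rw [tendsto_smallSets_iff]
    intro s hs
    obtain ⟨δ, hδ, hball⟩ := Metric.mem_nhds_iff.1 hs
    filter_upwards [hα.eventually (lt_mem_nhds (neg_lt_zero.2 hδ)),
      hβ.eventually (gt_mem_nhds hδ)] with k h1 h2 r hr
    have h3 := hρt k (subset_tsupport _ hr)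
    refine hball ?_
    rw [Metric.mem_ball, Real.dist_eq, sub_zero, abs_lt]
    exact ⟨h1.trans h3.1, h3.2.trans h2⟩
  set xk : ℕ → ℝ → W := fun k =>
    ρ k ⋆[ContinuousLinearMap.lsmul ℝ ℝ, volume] (Ioo 0 T).indicator w with hxk
  set gk : ℕ → ℝ → StrongDual ℝ W := fun k =>
    ρ k ⋆[ContinuousLinearMap.lsmul ℝ ℝ, volume] (Ioo 0 T).indicator g with hgk
  have hxc : ∀ k, Continuous (xk k) := fun k =>
    (hρs k).continuous_convolution_left _ (hρc k) hlw
  have hgc : ∀ k, Continuous (gk k) := fun k =>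
    (hρs k).continuous_convolution_left _ (hρc k) hlg
  have hxl := tendsto_eLpNorm_convolution_sub hmw hρc hρs hρ0 hρ1 hρsmall
  have hgl := tendsto_eLpNorm_convolution_sub hmg hρc hρs hρ0 hρ1 hρsmall
  have hxd : ∀ k t, HasDerivAt (xk k)
      ((deriv (ρ k) ⋆[ContinuousLinearMap.lsmul ℝ ℝ, volume] (Ioo 0 T).indicator w) t) t :=
    fun k t => (hρs k).hasDerivAt_convolution_left _ ((hρ k).of_le (by simp)) hlw t
  have hxg : ∀ k, ∀ t ∈ Icc a b, D (i ((deriv (ρ k) ⋆[ContinuousLinearMap.lsmul ℝ ℝ, volume]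
      (Ioo 0 T).indicator w) t)) = gk k t := fun k t ht =>
    hd.convolution_deriv i D hw (hρ k) (hρs k) (hρt k) (hsub k t ht)
  refine exists_continuousOn_of_energy_approx i hab hmw hmg
    (fun k => memLp_convolution hmw (hρc k) (hρs k) (hρ0 k) (hρ1 k))
    (fun k => memLp_convolution hmg (hρc k) (hρs k) (hρ0 k) (hρ1 k)) hxc hxl hgl
    (fun k l s hs t ht => ?_) (fun k s hs t ht => ?_)
  · have hst : uIcc s t ⊆ Icc a b := uIcc_subset_Icc hs ht
    exact norm_sq_sub_norm_sq_eq_integral i D hD (fun r _ => (hxd k r).sub (hxd l r))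
      ((hgc k).sub (hgc l)) fun r hr => by
        rw [map_sub, map_sub, hxg k r (hst hr), hxg l r (hst hr)]
  · have hst : uIcc s t ⊆ Icc a b := uIcc_subset_Icc hs ht
    exact norm_sq_sub_norm_sq_eq_integral i D hD (fun r _ => hxd k r) (hgc k)
      fun r hr => hxg k r (hst hr)

theorem ContinuousOn.eq_of_ae_eq {Y : Type*} [TopologicalSpace Y] [T2Space Y] {a b : ℝ}
    (hab : a < b) {f g : ℝ → Y} (hf : ContinuousOn f (Icc a b)) (hg : ContinuousOn g (Icc a b))
    (h : ∀ᵐ t, t ∈ Ioo a b → f t = g t) : ∀ t ∈ Icc a b, f t = g t := by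
  have h' : f =ᵐ[volume.restrict (Icc a b)] g := by
    rw [← Measure.restrict_congr_set Ioo_ae_eq_Icc]
    exact (ae_restrict_iff' measurableSet_Ioo).2 h
  exact Measure.eqOn_Icc_of_ae_eq volume hab.ne h' hf hg

/-- The Lions–Magenes lemma: if `w ∈ L²(0,T;W)` and `w' ∈ L²(0,T;W')`, then `w` is continuous
with values in the pivot space and satisfies the energy identity. -/
theorem StefanRelaxation.HasH1Deriv.exists_isContRep {T : ℝ} (hT : 0 < T) (i : W →L[ℝ] K)
    (D : K →L[ℝ] StrongDual ℝ W) (hD : ∀ h v, D h v = inner ℝ h (i v))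
    {w : ℝ → W} {g : ℝ → StrongDual ℝ W} (hw : MemLp w 2 (timeMeasure T))
    (hd : HasH1Deriv T (fun t => D (i (w t))) g) :
    ∃ wc : ℝ → K, IsContRep T (fun t => i (w t)) wc ∧
      ∀ t ∈ Icc 0 T, ‖wc t‖ ^ 2 = ‖wc 0‖ ^ 2 + 2 * ∫ r in Ioo 0 t, g r (w r) := by
  have hδ : Tendsto (fun k : ℕ => T / 4 * (1 / ((k : ℝ) + 1))) atTop (𝓝 0) := by
    simpa using tendsto_one_div_add_atTop_nhds_zero_nat.const_mul (T / 4)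
  have hδ0 : ∀ k : ℕ, 0 < T / 4 * (1 / ((k : ℝ) + 1)) := fun k => by positivity
  have hδ1 : ∀ k : ℕ, T / 4 * (1 / ((k : ℝ) + 1)) ≤ T / 4 := fun k => by
    have : 1 / ((k : ℝ) + 1) ≤ 1 := by
      rw [div_le_one (by positivity)]
      linarith [(Nat.cast_nonneg k : (0 : ℝ) ≤ k)]
    nlinarith
  -- A kernel supported in negative `s` evaluates `w` at times later than `t`, so `t = 0` is
  -- allowed. The bound `T / 4` keeps these times below `T` for `t ≤ 2T/3`. The mirror choice next
  -- serves `[T/3, T]`.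
  obtain ⟨x, hxc, hxa, hxe⟩ := hd.exists_continuousOn_Icc i D hD hw
    (show (0 : ℝ) < 2 * T / 3 by positivity) (α := fun k => -(T / 4 * (1 / ((k : ℝ) + 1))))
    (β := fun _ => 0) (fun k => neg_lt_zero.2 (hδ0 k)) (by simpa using hδ.neg) tendsto_const_nhds
    (fun k t ht s hs => ⟨by linarith [ht.1, hs.2], by linarith [ht.2, hs.1, hδ1 k]⟩)
  obtain ⟨y, hyc, hya, hye⟩ := hd.exists_continuousOn_Icc i D hD hw
    (show T / 3 < T by linarith) (α := fun _ => 0)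
    (β := fun k => T / 4 * (1 / ((k : ℝ) + 1))) hδ0 tendsto_const_nhds hδ
    (fun k t ht s hs => ⟨by linarith [ht.1, hs.2, hδ1 k], by linarith [ht.2, hs.1]⟩)
  have hxy : ∀ t ∈ Icc (T / 3) (2 * T / 3), x t = y t := by
    refine ContinuousOn.eq_of_ae_eq (by linarith)
      (hxc.mono (Icc_subset_Icc (by positivity) le_rfl))
      (hyc.mono (Icc_subset_Icc le_rfl (by linarith))) ?_
    filter_upwards [hxa, hya] with t h1 h2 ht
    rw [h1 ⟨by linarith [ht.1], ht.2.le⟩, h2 ⟨ht.1.le, by linarith [ht.2]⟩]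
  set z : ℝ → K := fun t => if t ≤ T / 2 then x t else y t with hz
  have hzx : ∀ t ∈ Icc 0 (2 * T / 3), z t = x t := by
    intro t ht
    by_cases h : t ≤ T / 2
    · simp [hz, h]
    · simp only [hz, h, if_false]
      exact (hxy t ⟨by linarith, ht.2⟩).symm
  have hzy : ∀ t ∈ Icc (T / 3) T, z t = y t := by
    intro t ht
    by_cases h : t ≤ T / 2
    · simp only [hz, h, if_true]
      exact hxy t ⟨ht.1, by linarith⟩
    · simp [hz, h]
  have hcov : Icc 0 T = Icc 0 (2 * T / 3) ∪ Icc (T / 3) T := by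
    ext t
    simp only [mem_Icc, mem_union]
    constructor
    · intro h
      by_cases h' : t ≤ T / 2
      · exact Or.inl ⟨h.1, by linarith⟩
      · exact Or.inr ⟨by linarith, h.2⟩
    · rintro (h | h)
      · exact ⟨h.1, by linarith [h.2]⟩
      · exact ⟨by linarith [h.1], h.2⟩
  refine ⟨z, ⟨?_, ?_⟩, fun t ht => ?_⟩
  · rw [hcov]
    exact (hxc.congr hzx).union_of_isClosed (hyc.congr hzy) isClosed_Icc isClosed_Icc
  · rw [ae_restrict_iff' measurableSet_Ioo]
    filter_upwards [hxa, hya] with t h1 h2 ht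
    have hI : (Ioo 0 T).indicator w t = w t := indicator_of_mem ht _
    rw [hI] at h1 h2
    rcases hcov ▸ Ioo_subset_Icc_self ht with h | h
    · rw [hzx t h, h1 h]
    · rw [hzy t h, h2 h]
  · have hint : Integrable (fun r => (Ioo 0 T).indicator g r ((Ioo 0 T).indicator w r)) :=
      (memLp_indicator_Ioo hd.memLp_deriv).integrable_dual_apply (memLp_indicator_Ioo hw)
    have heq : ∫ r in Ioo 0 t, g r (w r) =
        ∫ r in 0..t, (Ioo 0 T).indicator g r ((Ioo 0 T).indicator w r) := by
      rw [intervalIntegral.integral_of_le ht.1, integral_Ioc_eq_integral_Ioo]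
      refine setIntegral_congr_fun measurableSet_Ioo fun r hr => ?_
      have hr' : r ∈ Ioo 0 T := ⟨hr.1, hr.2.trans_le ht.2⟩
      simp [hr']
    rw [heq]
    have h0 : (0 : ℝ) ∈ Icc 0 (2 * T / 3) := ⟨le_rfl, by positivity⟩
    rcases hcov ▸ ht with h | h
    · rw [hzx t h, hzx 0 h0]
      linarith [hxe 0 h0 t h]
    -- Beyond the left window, the identity on `[0, T/2]` for `x` is added to the one on `[T/2, t]`
    -- for `y`.
    · have hm : T / 2 ∈ Icc 0 (2 * T / 3) := ⟨by positivity, by linarith⟩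
      have hm' : T / 2 ∈ Icc (T / 3) T := ⟨by linarith, by linarith⟩
      have e1 := hxe 0 h0 _ hm
      have e2 := hye _ hm' t h
      rw [← hxy (T / 2) ⟨hm'.1, hm.2⟩] at e2
      rw [hzy t h, hzx 0 h0, ← intervalIntegral.integral_add_adjacent_intervals
        (b := T / 2) hint.intervalIntegrable hint.intervalIntegrable]
      linarith

end GelfandTriple

/-! ### Completeness of `V` and injectivity of the embeddings -/

section Spaces

variable {n : ℕ}

theorem integral_mul_eq_inner_toLp {Ω : Set (E n)} {ψ : E n → ℝ}
    (hψ : MemLp ψ 2 (volume.restrict Ω)) (v : H Ω) :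
    ∫ x in Ω, v x * ψ x = inner ℝ (hψ.toLp ψ) v := by
  rw [L2.inner_def]
  refine integral_congr_ae ?_
  filter_upwards [hψ.coeFn_toLp] with x hx
  rw [hx]
  simp

theorem integral_coord_mul_eq_inner_toLp {Ω : Set (E n)} {ψ : E n → ℝ}
    (hψ : MemLp ψ 2 (volume.restrict Ω)) (i : Fin n) :
    ∃ G : HVec Ω, ∀ g : HVec Ω, ∫ x in Ω, g x i * ψ x = inner ℝ G g := by
  have hm : MemLp (fun x => ψ x • EuclideanSpace.single i (1 : ℝ)) 2 (volume.restrict Ω) :=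
    ((ContinuousLinearMap.id ℝ ℝ).smulRight (EuclideanSpace.single i (1 : ℝ))).comp_memLp' hψ
  refine ⟨hm.toLp _, fun g => ?_⟩
  rw [L2.inner_def]
  refine integral_congr_ae ?_
  filter_upwards [hm.coeFn_toLp] with x hx
  rw [hx, real_inner_smul_left, EuclideanSpace.inner_single_left]
  simp [mul_comm]

/-- Each defining equation compares two continuous functionals, namely inner products with fixed
`L²` elements. -/
theorem isClosed_H1 (Ω : Set (E n)) : IsClosed (H1 Ω : Set (Pairs Ω)) := by
  have : (H1 Ω : Set (Pairs Ω)) = ⋂ (φ : E n → ℝ) (_ : IsTestFunction Ω φ) (i : Fin n),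
      {p : Pairs Ω | ∫ x in Ω, p.fst x * fderiv ℝ φ x (EuclideanSpace.single i 1) =
        - ∫ x in Ω, p.snd x i * φ x} := by
    ext p
    simp only [mem_iInter]
    rfl
  rw [this]
  refine isClosed_iInter fun φ => isClosed_iInter fun hφ => isClosed_iInter fun i => ?_
  obtain ⟨G, hG⟩ := integral_coord_mul_eq_inner_toLp hφ.memLp i
  simp only [hG, integral_mul_eq_inner_toLp (hφ.memLp_fderiv (EuclideanSpace.single i 1))]
  refine isClosed_eq ?_ ?_
  · exact continuous_const.inner (WithLp.fstL 2 ℝ (H Ω) (HVec Ω)).continuous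
  · exact (continuous_const.inner (WithLp.sndL 2 ℝ (H Ω) (HVec Ω)).continuous).neg

theorem eLpNorm_sub_coeFn_le {X F : Type*} [MeasurableSpace X] [NormedAddCommGroup F]
    {μ : Measure X} {f : X → F} (hf : AEStronglyMeasurable f μ) (p q : Lp F 2 μ) :
    eLpNorm (fun x => f x - p x) 2 μ ≤ eLpNorm (fun x => f x - q x) 2 μ + ‖q - p‖ₑ := by
  have e : (fun x => f x - p x) =ᵐ[μ] (fun x => f x - q x) + fun x => (q - p : Lp F 2 μ) x := by
    filter_upwards [Lp.coeFn_sub q p] with x hx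
    simp only [Pi.add_apply, hx, Pi.sub_apply]
    abel
  rw [eLpNorm_congr_ae e, Lp.enorm_def]
  exact eLpNorm_add_le (hf.sub (Lp.aestronglyMeasurable q)) (Lp.aestronglyMeasurable _)
    (by norm_num)

/-- Diagonal argument: approximate the limit by a pair with zero trace within `1/(k+1)`, then choose
one smooth function within `1/(k+1)` of that pair. The trace condition needs no correction, the
target being `0` throughout. -/
theorem isClosed_hasTrace_zero (Ω Γ₀ : Set (E n)) :
    IsClosed {p : Pairs Ω | HasTrace Ω Γ₀ p 0} := by
  refine isClosed_of_closure_subset fun p hp => ?_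
  have hk : ∀ k : ℕ, ∃ φ : E n → ℝ, ContDiff ℝ ∞ φ ∧
      eLpNorm (fun x => φ x - p.fst x) 2 (volume.restrict Ω) ≤
        ((k + 1 : ℕ) : ℝ≥0∞)⁻¹ + ((k + 1 : ℕ) : ℝ≥0∞)⁻¹ ∧
      eLpNorm (fun x => gradient φ x - p.snd x) 2 (volume.restrict Ω) ≤
        ((k + 1 : ℕ) : ℝ≥0∞)⁻¹ + ((k + 1 : ℕ) : ℝ≥0∞)⁻¹ ∧
      eLpNorm (fun x => φ x - (0 : Lp ℝ 2 (surface Γ₀)) x) 2 (surface Γ₀) ≤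
        ((k + 1 : ℕ) : ℝ≥0∞)⁻¹ + ((k + 1 : ℕ) : ℝ≥0∞)⁻¹ := by
    intro k
    have hpos : (0 : ℝ≥0∞) < ((k + 1 : ℕ) : ℝ≥0∞)⁻¹ :=
      ENNReal.inv_pos.2 (ENNReal.natCast_ne_top _)
    obtain ⟨q, ⟨φ, hφ, h1, h2, h3⟩, hpq⟩ := EMetric.mem_closure_iff.1 hp _ hpos
    obtain ⟨m, m1, m2, m3⟩ := ((h1.eventually (gt_mem_nhds hpos)).and
      ((h2.eventually (gt_mem_nhds hpos)).and (h3.eventually (gt_mem_nhds hpos)))).exists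
    rw [edist_comm, edist_eq_enorm_sub] at hpq
    have hf : ‖q.fst - p.fst‖ₑ ≤ ‖q - p‖ₑ := by
      have := WithLp.enorm_fst_le (p := 2) _ (q - p)
      simpa using this
    have hs : ‖q.snd - p.snd‖ₑ ≤ ‖q - p‖ₑ := by
      have := WithLp.enorm_snd_le (p := 2) _ (q - p)
      simpa using this
    refine ⟨φ m, hφ m, ?_, ?_, m3.le.trans le_self_add⟩
    · exact (eLpNorm_sub_coeFn_le (hφ m).continuous.aestronglyMeasurable _ q.fst).trans
        (add_le_add m1.le (hf.trans hpq.le))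
    · exact (eLpNorm_sub_coeFn_le (continuous_gradient (hφ m)).aestronglyMeasurable _ q.snd).trans
        (add_le_add m2.le (hs.trans hpq.le))
  choose φ hφ h1 h2 h3 using hk
  have hlim : Tendsto (fun k : ℕ => ((k + 1 : ℕ) : ℝ≥0∞)⁻¹ + ((k + 1 : ℕ) : ℝ≥0∞)⁻¹) atTop
      (𝓝 0) := by
    have h := ENNReal.tendsto_inv_nat_nhds_zero.comp (tendsto_add_atTop_nat 1)
    simpa [Function.comp_def] using h.add h
  exact ⟨φ, hφ, tendsto_of_tendsto_of_tendsto_of_le_of_le tendsto_const_nhds hlim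
      (fun _ => zero_le) h1,
    tendsto_of_tendsto_of_tendsto_of_le_of_le tendsto_const_nhds hlim (fun _ => zero_le) h2,
    tendsto_of_tendsto_of_tendsto_of_le_of_le tendsto_const_nhds hlim (fun _ => zero_le) h3⟩

/-- Completeness of `V` is required for the Bochner integrals in the convolutions of `V`-valued
functions. -/
instance completeSpace_V (Ω Γ₀ : Set (E n)) : CompleteSpace (V Ω Γ₀) :=
  ((isClosed_H1 Ω).inter (isClosed_hasTrace_zero Ω Γ₀)).completeSpace_coe

theorem ae_eq_zero_of_forall_integral_mul_testFunction {Ω : Set (E n)} (hΩ : IsOpen Ω)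
    {f : E n → ℝ} (hf : MemLp f 2 (volume.restrict Ω))
    (h : ∀ φ, IsTestFunction Ω φ → ∫ x in Ω, f x * φ x = 0) :
    f =ᵐ[volume.restrict Ω] 0 := by
  have h1 := hΩ.ae_eq_zero_of_integral_contDiff_smul_eq_zero (μ := volume.restrict Ω)
    ((hf.locallyIntegrable (by norm_num)).locallyIntegrableOn Ω) fun φ h1 h2 h3 => by
      rw [← h φ ⟨h1, h2, h3⟩]
      exact integral_congr_ae (ae_of_all _ fun x => by simp [mul_comm])
  filter_upwards [h1, ae_restrict_mem hΩ.measurableSet] with x hx hm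
  exact hx hm

theorem gradient_apply {φ : E n → ℝ} (x : E n) (i : Fin n) :
    gradient φ x i = fderiv ℝ φ x (EuclideanSpace.single i 1) := by
  have h : inner ℝ (gradient φ x) (EuclideanSpace.single i (1 : ℝ)) =
      fderiv ℝ φ x (EuclideanSpace.single i 1) := by
    rw [gradient, InnerProductSpace.toDual_symm_apply]
  rw [← h, EuclideanSpace.inner_single_right]
  simp

theorem StefanRelaxation.IsTestFunction.memLp_gradient {Ω : Set (E n)} {φ : E n → ℝ}
    (hφ : IsTestFunction Ω φ) : MemLp (gradient φ) 2 (volume.restrict Ω) := by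
  have hs : HasCompactSupport (gradient φ) :=
    (hφ.hasCompactSupport.fderiv ℝ).comp_left (g := (InnerProductSpace.toDual ℝ (E n)).symm)
      (map_zero _)
  exact ((continuous_gradient hφ.contDiff).memLp_of_hasCompactSupport hs).restrict Ω

theorem StefanRelaxation.IsTestFunction.eq_zero_of_notMem {X : Type*} [NormedAddCommGroup X]
    [NormedSpace ℝ X] {U : Set X} {φ : X → ℝ} (hφ : IsTestFunction U φ) {x : X} (hx : x ∉ U) :
    φ x = 0 :=
  image_eq_zero_of_notMem_tsupport fun h => hx (hφ.tsupport_subset h)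

/-- Both integrands vanish off `Ω`, so integration by parts takes place on the whole space. -/
theorem StefanRelaxation.IsTestFunction.isWeakGradient {Ω : Set (E n)} {φ : E n → ℝ}
    (hφ : IsTestFunction Ω φ) :
    IsWeakGradient Ω (hφ.memLp.toLp φ) (hφ.memLp_gradient.toLp (gradient φ)) := by
  intro η hη i
  have e1 : ∫ x in Ω, (hφ.memLp.toLp φ) x * fderiv ℝ η x (EuclideanSpace.single i 1) =
      ∫ x, φ x * fderiv ℝ η x (EuclideanSpace.single i 1) := by
    refine Eq.trans (integral_congr_ae ?_)
      (setIntegral_eq_integral_of_forall_compl_eq_zero (s := Ω)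
        fun x hx => by rw [hφ.eq_zero_of_notMem hx, zero_mul])
    filter_upwards [hφ.memLp.coeFn_toLp] with x hx
    rw [hx]
  have e2 : ∫ x in Ω, (hφ.memLp_gradient.toLp (gradient φ)) x i * η x =
      ∫ x, fderiv ℝ φ x (EuclideanSpace.single i 1) * η x := by
    refine Eq.trans (integral_congr_ae ?_)
      (setIntegral_eq_integral_of_forall_compl_eq_zero (s := Ω)
        fun x hx => by rw [hη.eq_zero_of_notMem hx, mul_zero])
    filter_upwards [hφ.memLp_gradient.coeFn_toLp] with x hx
    rw [hx, gradient_apply]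
  have c1 : Continuous fun x => fderiv ℝ φ x (EuclideanSpace.single i 1) :=
    (hφ.contDiff.continuous_fderiv (by simp)).clm_apply continuous_const
  have c2 : Continuous fun x => fderiv ℝ η x (EuclideanSpace.single i 1) :=
    (hη.contDiff.continuous_fderiv (by simp)).clm_apply continuous_const
  have k1 := hφ.contDiff.continuous
  have k2 := hη.contDiff.continuous
  rw [e1, e2]
  exact integral_mul_fderiv_eq_neg_fderiv_mul_of_integrable
    ((c1.mul k2).integrable_of_hasCompactSupport hη.hasCompactSupport.mul_left)
    ((k1.mul c2).integrable_of_hasCompactSupport hφ.hasCompactSupport.mul_right)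
    ((k1.mul k2).integrable_of_hasCompactSupport hφ.hasCompactSupport.mul_right)
    (fun x _ => hφ.contDiff.differentiable (by simp) x)
    (fun x _ => hη.contDiff.differentiable (by simp) x)

/-- The constant sequence works: `Γ₀` lies in the boundary of an open set, where `φ` vanishes. -/
theorem StefanRelaxation.IsTestFunction.hasTrace_zero {Ω Γ₀ : Set (E n)} (hΩ : IsOpen Ω)
    (hΓ : MeasurableSet Γ₀) (hΓΩ : Γ₀ ⊆ frontier Ω) {φ : E n → ℝ} (hφ : IsTestFunction Ω φ) :
    HasTrace Ω Γ₀ (WithLp.toLp 2 (hφ.memLp.toLp φ, hφ.memLp_gradient.toLp (gradient φ))) 0 := by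
  refine ⟨fun _ => φ, fun _ => hφ.contDiff, ?_, ?_, ?_⟩
  · refine tendsto_const_nhds.congr fun _ => ?_
    rw [← eLpNorm_zero (ε := ℝ) (p := 2) (μ := volume.restrict Ω)]
    refine eLpNorm_congr_ae ?_
    filter_upwards [hφ.memLp.coeFn_toLp] with x hx
    simp [hx]
  · refine tendsto_const_nhds.congr fun _ => ?_
    rw [← eLpNorm_zero (ε := E n) (p := 2) (μ := volume.restrict Ω)]
    refine eLpNorm_congr_ae ?_
    filter_upwards [hφ.memLp_gradient.coeFn_toLp] with x hx
    simp [hx]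
  · refine tendsto_const_nhds.congr fun _ => ?_
    rw [← eLpNorm_zero (ε := ℝ) (p := 2) (μ := surface Γ₀)]
    refine eLpNorm_congr_ae ?_
    filter_upwards [Lp.coeFn_zero ℝ 2 (surface Γ₀), ae_restrict_mem hΓ] with x hx hm
    have hx' : x ∉ Ω := fun h => (hΩ.inter_frontier_eq ▸ ⟨h, hΓΩ hm⟩ : x ∈ (∅ : Set (E n)))
    rw [hx, hφ.eq_zero_of_notMem hx']
    simp

/-- Test functions belong to `V`, so an element of `H` that annihilates `V` vanishes by the
fundamental lemma of the calculus of variations. -/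
theorem toDual_injective {Ω Γ₀ : Set (E n)} (hΩ : IsOpen Ω) (hΓ : MeasurableSet Γ₀)
    (hΓΩ : Γ₀ ⊆ frontier Ω) : Function.Injective (toDual Ω Γ₀) := by
  rw [injective_iff_map_eq_zero]
  intro h hh
  rw [Lp.eq_zero_iff_ae_eq_zero]
  refine ae_eq_zero_of_forall_integral_mul_testFunction hΩ (Lp.memLp h) fun φ hφ => ?_
  let v : V Ω Γ₀ := ⟨WithLp.toLp 2 (hφ.memLp.toLp φ, hφ.memLp_gradient.toLp (gradient φ)),
    hφ.isWeakGradient, hφ.hasTrace_zero hΩ hΓ hΓΩ⟩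
  have hv : toDual Ω Γ₀ h v = 0 := by rw [hh]; rfl
  rw [integral_mul_eq_inner_toLp hφ.memLp, real_inner_comm]
  exact hv

theorem toH_injective {Ω Γ₀ : Set (E n)} (hΩ : IsOpen Ω) : Function.Injective (toH Ω Γ₀) := by
  rw [injective_iff_map_eq_zero]
  intro v hv
  have h1 : v.1.fst = 0 := hv
  have hw : IsWeakGradient Ω v.1.fst v.1.snd := v.2.1
  have h2 : v.1.snd = 0 := by
    rw [Lp.eq_zero_iff_ae_eq_zero]
    have hi : ∀ i, (fun x => v.1.snd x i) =ᵐ[volume.restrict Ω] 0 := fun i => by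
      refine ae_eq_zero_of_forall_integral_mul_testFunction hΩ (memLp_coord _ i) fun φ hφ => ?_
      have := hw φ hφ i
      rw [h1, integral_mul_eq_inner_toLp (hφ.memLp_fderiv _), inner_zero_right] at this
      linarith
    filter_upwards [eventually_countable_forall.2 hi] with x hx
    ext i
    exact hx i
  exact Subtype.ext (WithLp.ofLp_injective 2 (Prod.ext h1 h2))

theorem norm_sq_V {Ω Γ₀ : Set (E n)} (v : V Ω Γ₀) :
    ‖v‖ ^ 2 = ‖toH Ω Γ₀ v‖ ^ 2 + ‖grad Ω Γ₀ v‖ ^ 2 :=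
  WithLp.prod_norm_sq_eq_of_L2 v.1

theorem A_apply_self {Ω Γ₀ : Set (E n)} (v : V Ω Γ₀) : A Ω Γ₀ v v = ‖grad Ω Γ₀ v‖ ^ 2 :=
  real_inner_self_eq_norm_sq (grad Ω Γ₀ v)

end Spaces

/-! ### Continuous representatives, weak derivatives and slices of `L²(Q)` -/

section TimeDependent

variable {B B' : Type*} [NormedAddCommGroup B] [NormedAddCommGroup B']

theorem StefanRelaxation.IsContRep.eq {T : ℝ} (hT : 0 < T) {w x y : ℝ → B}
    (hx : IsContRep T w x) (hy : IsContRep T w y) : ∀ t ∈ Icc 0 T, x t = y t := by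
  refine ContinuousOn.eq_of_ae_eq hT hx.1 hy.1 ((ae_restrict_iff' measurableSet_Ioo).1 ?_)
  filter_upwards [hx.2, hy.2] with t h1 h2
  rw [h1, h2]

theorem StefanRelaxation.IsContRep.sub {T : ℝ} {w₁ w₂ x₁ x₂ : ℝ → B}
    (h₁ : IsContRep T w₁ x₁) (h₂ : IsContRep T w₂ x₂) :
    IsContRep T (fun t => w₁ t - w₂ t) (fun t => x₁ t - x₂ t) := by
  refine ⟨h₁.1.sub h₂.1, ?_⟩
  filter_upwards [h₁.2, h₂.2] with t a b
  rw [a, b]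

theorem norm_sq_eq_integral {X : Type*} [MeasurableSpace X] {μ : Measure X} (f : Lp B 2 μ) :
    ‖f‖ ^ 2 = ∫ x, ‖f x‖ ^ 2 ∂μ := by
  have h := (Lp.memLp f).eLpNorm_eq_integral_rpow_norm (by norm_num) (by norm_num)
  have h0 : 0 ≤ ∫ x, ‖f x‖ ^ 2 ∂μ := integral_nonneg fun _ => by positivity
  simp only [ENNReal.toReal_ofNat, Real.rpow_ofNat] at h
  rw [Lp.norm_def, h, ENNReal.toReal_ofReal (by positivity), ← Real.rpow_natCast,
    ← Real.rpow_mul h0]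
  norm_num

variable [NormedSpace ℝ B] [NormedSpace ℝ B']

theorem integrable_smul_of_memLp_two {T : ℝ} {φ : ℝ → ℝ} (hφ : Continuous φ)
    (hφs : HasCompactSupport φ) {w : ℝ → B} (hw : MemLp w 2 (timeMeasure T)) :
    Integrable (fun t => φ t • w t) (timeMeasure T) :=
  memLp_one_iff_integrable.1
    (hw.smul ((hφ.memLp_of_hasCompactSupport hφs).restrict _ : MemLp φ 2 (timeMeasure T)))

theorem StefanRelaxation.IsTestFunction.continuous_deriv {U : Set ℝ} {φ : ℝ → ℝ}
    (hφ : IsTestFunction U φ) : Continuous (deriv φ) :=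
  hφ.contDiff.continuous_deriv (by simp)

theorem StefanRelaxation.HasH1Deriv.sub [CompleteSpace B] {T : ℝ} {w₁ w₂ g₁ g₂ : ℝ → B}
    (h₁ : HasH1Deriv T w₁ g₁) (h₂ : HasH1Deriv T w₂ g₂) :
    HasH1Deriv T (fun t => w₁ t - w₂ t) (fun t => g₁ t - g₂ t) := by
  refine ⟨h₁.memLp.sub h₂.memLp, h₁.memLp_deriv.sub h₂.memLp_deriv, fun φ hφ => ?_⟩
  have c := hφ.contDiff.continuous
  have s := hφ.hasCompactSupport
  simp only [smul_sub]
  rw [integral_sub (integrable_smul_of_memLp_two hφ.continuous_deriv s.deriv h₁.memLp)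
      (integrable_smul_of_memLp_two hφ.continuous_deriv s.deriv h₂.memLp),
    integral_sub (integrable_smul_of_memLp_two c s h₁.memLp_deriv)
      (integrable_smul_of_memLp_two c s h₂.memLp_deriv),
    h₁.integral_eq φ hφ, h₂.integral_eq φ hφ]
  abel

theorem StefanRelaxation.HasH1Deriv.clm_comp [CompleteSpace B] [CompleteSpace B'] {T : ℝ}
    {w g : ℝ → B} (h : HasH1Deriv T w g) (D : B →L[ℝ] B') :
    HasH1Deriv T (fun t => D (w t)) (fun t => D (g t)) := by
  refine ⟨D.comp_memLp' h.memLp, D.comp_memLp' h.memLp_deriv, fun φ hφ => ?_⟩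
  simp only [← map_smul]
  rw [D.integral_comp_comm (integrable_smul_of_memLp_two hφ.continuous_deriv
      hφ.hasCompactSupport.deriv h.memLp),
    D.integral_comp_comm (integrable_smul_of_memLp_two hφ.contDiff.continuous
      hφ.hasCompactSupport h.memLp_deriv), h.integral_eq φ hφ, map_neg]

theorem integral_sq_slice_L2Q {n : ℕ} {T : ℝ} {Ω : Set (E n)} (u : L2Q T Ω) :
    (∀ᵐ t ∂timeMeasure T, Integrable (fun x => u (t, x) ^ 2) (volume.restrict Ω)) ∧
      Integrable (fun t => ∫ x in Ω, u (t, x) ^ 2) (timeMeasure T) ∧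
      ∫ t in Ioo 0 T, ∫ x in Ω, u (t, x) ^ 2 = ‖u‖ ^ 2 := by
  have hμ : (volume : Measure (ℝ × E n)).restrict (Ioo 0 T ×ˢ Ω) =
      (timeMeasure T).prod (volume.restrict Ω) := by
    rw [Measure.prod_restrict]; rfl
  have hi : Integrable (fun p => u p ^ 2) ((timeMeasure T).prod (volume.restrict Ω)) := by
    rw [← hμ]
    exact (Lp.memLp u).integrable_sq
  refine ⟨hi.prod_right_ae, hi.integral_prod_left, ?_⟩
  rw [norm_sq_eq_integral]
  simp only [Real.norm_eq_abs, sq_abs]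
  refine (integral_prod _ hi).symm.trans ?_
  rw [← hμ]

theorem ae_ae_of_ae_L2Q {n : ℕ} {T : ℝ} {Ω : Set (E n)} {p : ℝ × E n → Prop}
    (h : ∀ᵐ z ∂(volume : Measure (ℝ × E n)).restrict (Ioo 0 T ×ˢ Ω), p z) :
    ∀ᵐ t ∂timeMeasure T, ∀ᵐ x ∂volume.restrict Ω, p (t, x) := by
  have hμ : (volume : Measure (ℝ × E n)).restrict (Ioo 0 T ×ˢ Ω) =
      (timeMeasure T).prod (volume.restrict Ω) := by
    rw [Measure.prod_restrict]; rfl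
  rw [hμ] at h
  exact Measure.ae_ae_of_ae_prod h

end TimeDependent

/-! ### Gronwall inequality with an `L¹` forcing term -/

section Gronwall

/-- Gronwall's differential form is applied to the right-hand side, which is differentiable because
`e` is continuous. -/
theorem le_mul_exp_of_le_add_integral {T D K : ℝ} (hD : 0 ≤ D) (hK : 0 ≤ K)
    {e : ℝ → ℝ} (he : Continuous e) (he0 : ∀ t, 0 ≤ e t)
    (h : ∀ t ∈ Icc 0 T, e t ≤ D + K * ∫ s in 0..t, e s) :
    ∀ t ∈ Icc 0 T, e t ≤ D * Real.exp (K * t) := by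
  have hd : ∀ t, HasDerivAt (fun t => D + K * ∫ s in 0..t, e s) (K * e t) t := fun t =>
    ((intervalIntegral.integral_hasDerivAt_right (he.intervalIntegrable _ _)
      (he.stronglyMeasurableAtFilter _ _) he.continuousAt).const_mul K).const_add D
  have hi : ∀ t ∈ Icc 0 T, 0 ≤ ∫ s in 0..t, e s := fun t ht =>
    intervalIntegral.integral_nonneg ht.1 fun s _ => he0 s
  have key := norm_le_gronwallBound_of_norm_deriv_right_le (a := 0) (b := T) (δ := D) (K := K)
    (ε := 0) (f := fun t => D + K * ∫ s in 0..t, e s) (f' := fun t => K * e t)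
    (fun t _ => (hd t).continuousAt.continuousWithinAt) (fun t _ => (hd t).hasDerivWithinAt)
    (by simp [abs_of_nonneg hD]) fun t ht => by
      have h1 := h t ⟨ht.1, ht.2.le⟩
      rw [add_zero, Real.norm_of_nonneg (mul_nonneg hK (he0 t)),
        Real.norm_of_nonneg ((he0 t).trans h1)]
      exact mul_le_mul_of_nonneg_left h1 hK
  intro t ht
  have h2 := key t ht
  rw [gronwallBound_ε0, sub_zero] at h2
  exact (h t ht).trans ((le_abs_self _).trans h2)

/-- Take `M` to be the maximum of `e` over `[0,T]`. Gronwall bounds `M` by an expression containing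
`√M`, which can be absorbed. -/
theorem le_of_le_add_sqrt_add_integral {T D K δ : ℝ} (hT : 0 < T) (hD : 0 ≤ D) (hK : 0 ≤ K)
    (hδ : 0 ≤ δ) {e : ℝ → ℝ} (he : ContinuousOn e (Icc 0 T)) (he0 : ∀ t, 0 ≤ e t)
    (h : ∀ M, (∀ t ∈ Icc 0 T, e t ≤ M) → ∀ t ∈ Icc 0 T,
      e t ≤ D + 2 * √M * δ + K * ∫ s in Ioo 0 t, e s) :
    ∀ t ∈ Icc 0 T, e t ≤ 2 * (D * Real.exp (K * T)) + 4 * (δ * Real.exp (K * T)) ^ 2 := by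
  obtain ⟨m, hm, hmax⟩ := isCompact_Icc.exists_isMaxOn (nonempty_Icc.2 hT.le) he
  have hM : ∀ t ∈ Icc 0 T, e t ≤ e m := fun t ht => hmax ht
  have hec : Continuous (IccExtend hT.le ((Icc 0 T).domRestrict e)) :=
    (continuousOn_iff_continuous_domRestrict.1 he).Icc_extend'
  have heq : ∀ t ∈ Icc 0 T, IccExtend hT.le ((Icc 0 T).domRestrict e) t = e t := fun t ht => by
    rw [IccExtend_of_mem _ _ ht]; rfl
  have hD' : 0 ≤ D + 2 * √(e m) * δ := by positivity
  have key := le_mul_exp_of_le_add_integral (T := T) hD' hK hec (fun t => he0 _) fun t ht => by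
    rw [heq t ht]
    refine (h _ hM t ht).trans (le_of_eq ?_)
    rw [intervalIntegral.integral_of_le ht.1, integral_Ioc_eq_integral_Ioo]
    congr 2
    refine setIntegral_congr_fun measurableSet_Ioo fun s hs => ?_
    exact (heq s ⟨hs.1.le, hs.2.le.trans ht.2⟩).symm
  have h1 := key m hm
  rw [heq m hm] at h1
  have h2 : e m ≤ (D + 2 * √(e m) * δ) * Real.exp (K * T) := by
    refine h1.trans (mul_le_mul_of_nonneg_left (Real.exp_le_exp.2 ?_) hD')
    exact mul_le_mul_of_nonneg_left hm.2 hK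
  intro t ht
  refine (hM t ht).trans ?_
  have h3 := Real.sq_sqrt (he0 m)
  -- Young's inequality `2 √M y ≤ M / 2 + 2 y²` with `y = δ exp (K T)`; moving `M / 2` to the left
  -- doubles the remaining terms.
  nlinarith [sq_nonneg (√(e m) - 2 * (δ * Real.exp (K * T)))]

/-- As `a` is only integrable, `√e` is replaced by `√M` before integrating, leaving the plain
integral of `a`. -/
theorem le_of_ae_rate_le {T K : ℝ} (hT : 0 < T) (hK : 0 ≤ K) {e G a b : ℝ → ℝ}
    (he : ContinuousOn e (Icc 0 T)) (he0 : ∀ t, 0 ≤ e t)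
    (hG : Integrable G (timeMeasure T)) (ha : Integrable a (timeMeasure T))
    (hb : Integrable b (timeMeasure T)) (ha0 : ∀ t, 0 ≤ a t) (hb0 : ∀ t, 0 ≤ b t)
    (hrate : ∀ᵐ t ∂timeMeasure T, G t ≤ 2 * (a t * √(e t)) + b t + K * e t)
    (heq : ∀ t ∈ Icc 0 T, e t = e 0 + ∫ s in Ioo 0 t, G s) :
    ∀ t ∈ Icc 0 T, e t ≤ 2 * ((e 0 + ∫ s in Ioo 0 T, b s) * Real.exp (K * T)) +
      4 * ((∫ s in Ioo 0 T, a s) * Real.exp (K * T)) ^ 2 := by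
  have ie : Integrable e (timeMeasure T) :=
    (he.integrableOn_compact isCompact_Icc).mono_set Ioo_subset_Icc_self
  refine le_of_le_add_sqrt_add_integral hT
    (add_nonneg (he0 0) (integral_nonneg hb0)) hK (integral_nonneg ha0) he he0
    fun M hM t ht => ?_
  have hsub : Ioo 0 t ⊆ Ioo 0 T := Ioo_subset_Ioo le_rfl ht.2
  have hres : (volume.restrict (Ioo 0 t) : Measure ℝ) ≤ timeMeasure T :=
    Measure.restrict_mono hsub le_rfl
  have hrate' : ∀ᵐ s ∂volume.restrict (Ioo 0 t), G s ≤ (2 * √M) * a s + b s + K * e s := by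
    filter_upwards [ae_mono hres hrate, ae_restrict_mem measurableSet_Ioo] with s hs hm
    have h1 : √(e s) ≤ √M := Real.sqrt_le_sqrt (hM s (Ioo_subset_Icc_self (hsub hm)))
    linarith [mul_le_mul_of_nonneg_left h1 (ha0 s)]
  have i1 := (ha.const_mul (2 * √M)).mono_measure hres
  have i2 := hb.mono_measure hres
  have i3 := (ie.const_mul K).mono_measure hres
  have i12 : Integrable (fun s => (2 * √M) * a s + b s) (volume.restrict (Ioo 0 t)) := i1.add i2
  have hint := integral_mono_ae (hG.mono_measure hres) (i12.add i3) hrate'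
  simp only [Pi.add_apply] at hint
  rw [integral_add i12 i3, integral_add i1 i2, integral_const_mul, integral_const_mul] at hint
  have l1 : ∫ s in Ioo 0 t, a s ≤ ∫ s in Ioo 0 T, a s :=
    setIntegral_mono_set ha (ae_of_all _ ha0) hsub.eventuallyLE
  have l2 : ∫ s in Ioo 0 t, b s ≤ ∫ s in Ioo 0 T, b s :=
    setIntegral_mono_set hb (ae_of_all _ hb0) hsub.eventuallyLE
  have l3 := mul_le_mul_of_nonneg_left l1 (by positivity : 0 ≤ 2 * √M)
  have k1 := heq t ht
  linarith

end Gronwall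

/-! ### The norm of the sum space -/

section Data

variable {n : ℕ} {T : ℝ} {Ω Γ₀ : Set (E n)}

theorem StefanRelaxation.MemSum.sub {f₁ f₂ : ℝ → V' Ω Γ₀} (h₁ : MemSum T Ω Γ₀ f₁)
    (h₂ : MemSum T Ω Γ₀ f₂) : MemSum T Ω Γ₀ (fun t => f₁ t - f₂ t) := by
  obtain ⟨a, b, hab⟩ := h₁
  obtain ⟨c, d, hcd⟩ := h₂
  refine ⟨a - c, b - d, ?_⟩
  filter_upwards [hab, hcd, Lp.coeFn_sub a c, Lp.coeFn_sub b d] with t h1 h2 h3 h4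
  rw [h1, h2, h3, h4]
  simp only [Pi.sub_apply, map_sub]
  abel

theorem bddBelow_decomposition_norms (f : ℝ → V' Ω Γ₀) :
    BddBelow {r : ℝ | ∃ h₁ h₂, IsDecomposition T Ω Γ₀ f h₁ h₂ ∧ r = ‖h₁‖ + ‖h₂‖} := by
  refine ⟨0, ?_⟩
  rintro r ⟨h₁, h₂, -, rfl⟩
  positivity

/-- The infimum need not be attained; the bound passes to the limit along a minimizing sequence, by
continuity in the norm. -/
theorem StefanRelaxation.MemSum.le_sumNorm {f : ℝ → V' Ω Γ₀} (hf : MemSum T Ω Γ₀ f) {X a b C : ℝ}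
    (h : ∀ h₁ h₂, IsDecomposition T Ω Γ₀ f h₁ h₂ → X ≤ a + C * ((‖h₁‖ + ‖h₂‖) ^ 2 + b)) :
    X ≤ a + C * (sumNorm T Ω Γ₀ f ^ 2 + b) := by
  obtain ⟨h₁, h₂, hd⟩ := hf
  obtain ⟨r, -, hr, hmem⟩ := exists_seq_tendsto_sInf
    (S := {r : ℝ | ∃ h₁ h₂, IsDecomposition T Ω Γ₀ f h₁ h₂ ∧ r = ‖h₁‖ + ‖h₂‖})
    ⟨_, h₁, h₂, hd, rfl⟩ (bddBelow_decomposition_norms f)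
  refine ge_of_tendsto' (((hr.pow 2).add_const b).const_mul C |>.const_add a) fun k => ?_
  obtain ⟨k₁, k₂, hk, e⟩ := hmem k
  rw [e]
  exact h k₁ k₂ hk

theorem sumNorm_zero : sumNorm T Ω Γ₀ (fun _ => 0) = 0 := by
  refine le_antisymm (csInf_le (bddBelow_decomposition_norms _) ⟨0, 0, ?_, by simp⟩) ?_
  · filter_upwards [Lp.coeFn_zero (H Ω) 1 (timeMeasure T),
      Lp.coeFn_zero (V' Ω Γ₀) 2 (timeMeasure T)] with t h1 h2
    rw [h1, h2]
    simp
  · refine Real.sInf_nonneg ?_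
    rintro r ⟨h₁, h₂, -, rfl⟩
    positivity

end Data

/-! ### The energy estimate for the difference of two solutions -/

section Estimate

variable {n : ℕ} {T ε : ℝ} {Ω Γ₀ Γ₁ : Set (E n)}

theorem StefanRelaxation.IsMixedDomain.measurableSet₀ (h : IsMixedDomain Ω Γ₀ Γ₁) :
    MeasurableSet Γ₀ := by
  obtain ⟨U, hU, rfl⟩ := h.relOpen₀
  exact hU.measurableSet.inter isClosed_frontier.measurableSet

theorem StefanRelaxation.IsMixedDomain.subset_frontier₀ (h : IsMixedDomain Ω Γ₀ Γ₁) :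
    Γ₀ ⊆ frontier Ω := by
  obtain ⟨U, -, rfl⟩ := h.relOpen₀
  exact inter_subset_right

theorem StefanRelaxation.HasH1Deriv.exists_isContRep_toH (hT : 0 < T) {θ : ℝ → V Ω Γ₀}
    (hθ : MemLp θ 2 (timeMeasure T)) {θ' : ℝ → V' Ω Γ₀}
    (hd : HasH1Deriv T (fun t => toDual Ω Γ₀ (toH Ω Γ₀ (θ t))) θ') :
    ∃ θc : ℝ → H Ω, IsContRep T (fun t => toH Ω Γ₀ (θ t)) θc ∧ ∀ t ∈ Icc 0 T,
      ‖θc t‖ ^ 2 = ‖θc 0‖ ^ 2 + 2 * ∫ r in Ioo 0 t, θ' r (θ r) :=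
  hd.exists_isContRep (W := V Ω Γ₀) (K := H Ω) hT (toH Ω Γ₀) (toDual Ω Γ₀) (toDual_apply Ω Γ₀) hθ


theorem StefanRelaxation.IsContRep.toDual_comp {θ θc : ℝ → H Ω}
    (hθ : IsContRep T θ θc) :
    IsContRep T (fun t => toDual Ω Γ₀ (θ t)) (fun t => toDual Ω Γ₀ (θc t)) := by
  refine ⟨(toDual Ω Γ₀).continuous.comp_continuousOn hθ.1, ?_⟩
  filter_upwards [hθ.2] with t a
  rw [a]

theorem StefanRelaxation.IsContRep.toDual_zero_eq (hT : 0 < T) {θ θc : ℝ → H Ω}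
    (hθ : IsContRep T θ θc) {y : ℝ → V' Ω Γ₀}
    (hy : IsContRep T (fun t => toDual Ω Γ₀ (θ t)) y) : toDual Ω Γ₀ (θc 0) = y 0 :=
  hθ.toDual_comp.eq hT hy 0 ⟨le_rfl, hT.le⟩

theorem StefanRelaxation.HasH1Deriv.norm_sq_isContRep_toH (hT : 0 < T) {θ : ℝ → V Ω Γ₀}
    (hθ : MemLp θ 2 (timeMeasure T)) {θ' : ℝ → V' Ω Γ₀}
    (hd : HasH1Deriv T (fun t => toDual Ω Γ₀ (toH Ω Γ₀ (θ t))) θ') {θc : ℝ → H Ω}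
    (hc : IsContRep T (fun t => toH Ω Γ₀ (θ t)) θc) : ∀ t ∈ Icc 0 T,
      ‖θc t‖ ^ 2 = ‖θc 0‖ ^ 2 + 2 * ∫ r in Ioo 0 t, θ' r (θ r) := by
  obtain ⟨x, hx, he⟩ := hd.exists_isContRep_toH hT hθ
  intro t ht
  rw [hc.eq hT hx t ht, hc.eq hT hx 0 ⟨le_rfl, hT.le⟩]
  exact he t ht

/-- This is the trivial triple in which all spaces are `K`, with the Riesz map as `D`. -/
theorem StefanRelaxation.HasH1Deriv.norm_sq_isContRep {K : Type*} [NormedAddCommGroup K]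
    [InnerProductSpace ℝ K] [CompleteSpace K] (hT : 0 < T) {w g : ℝ → K} (hd : HasH1Deriv T w g)
    {wc : ℝ → K} (hc : IsContRep T w wc) : ∀ t ∈ Icc 0 T,
      ‖wc t‖ ^ 2 = ‖wc 0‖ ^ 2 + 2 * ∫ r in Ioo 0 t, inner ℝ (g r) (w r) := by
  obtain ⟨x, hx, he⟩ := (hd.clm_comp (innerSL ℝ : K →L[ℝ] StrongDual ℝ K)).exists_isContRep hT
    (ContinuousLinearMap.id ℝ K) (innerSL ℝ) (fun _ _ => rfl) hd.memLp
  intro t ht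
  rw [hc.eq hT hx t ht, hc.eq hT hx 0 ⟨le_rfl, hT.le⟩]
  exact he t ht

theorem StefanRelaxation.IsSolution.exists_isContRep (hT : 0 < T) (hΩ : IsMixedDomain Ω Γ₀ Γ₁)
    {ψ : EuclideanSpace ℝ (Fin 2) → ℝ} {f : ℝ → V' Ω Γ₀} {u : L2Q T Ω} {θ₀ χ₀ : H Ω}
    {θ : ℝ → V Ω Γ₀} {χ : ℝ → H Ω} (h : IsSolution T ε Ω Γ₀ ψ f u θ₀ χ₀ θ χ) :
    ∃ θc χc : ℝ → H Ω, IsContRep T (fun t => toH Ω Γ₀ (θ t)) θc ∧ IsContRep T χ χc ∧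
      θc 0 = θ₀ ∧ χc 0 = χ₀ := by
  obtain ⟨θ', χ', hθ, hdθ, -, -, -, ⟨y, hy, hy0⟩, ⟨χc, hχc, hχ0⟩⟩ := h
  obtain ⟨θc, hθc, -⟩ := hdθ.exists_isContRep_toH hT hθ
  refine ⟨θc, χc, hθc, hχc, ?_, hχ0⟩
  -- The initial condition only fixes the value at `0` in `V'`.
  apply toDual_injective hΩ.isOpen hΩ.measurableSet₀ hΩ.subset_frontier₀
  rw [← hy0]
  exact hθc.toDual_zero_eq hT hy

theorem norm_sq_le_of_ae_sq_le {a h k : H Ω} {v : E n → ℝ} {c : ℝ}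
    (hv : Integrable (fun x => v x ^ 2) (volume.restrict Ω))
    (hle : ∀ᵐ x ∂volume.restrict Ω, a x ^ 2 ≤ c * (2 * h x ^ 2 + 2 * v x ^ 2 + k x ^ 2)) :
    ‖a‖ ^ 2 ≤ c * (2 * ‖h‖ ^ 2 + 2 * (∫ x in Ω, v x ^ 2) + ‖k‖ ^ 2) := by
  have ha := (Lp.memLp a).integrable_sq
  have hh := (Lp.memLp h).integrable_sq.const_mul 2
  have hk := (Lp.memLp k).integrable_sq
  have hv' := hv.const_mul 2
  simp only [norm_sq_eq_integral, Real.norm_eq_abs, sq_abs]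
  have hhv : Integrable (fun x => 2 * h x ^ 2 + 2 * v x ^ 2) (volume.restrict Ω) := hh.add hv'
  rw [← integral_const_mul 2, ← integral_const_mul 2, ← integral_add hh hv',
    ← integral_add hhv hk, ← integral_const_mul]
  exact integral_mono_ae ha ((hhv.add hk).const_mul c) hle

theorem LipschitzWith.sq_sub_le {L : ℝ≥0} {ψ : EuclideanSpace ℝ (Fin 2) → ℝ}
    (hψ : LipschitzWith L ψ) (a₁ b₁ a₂ b₂ : ℝ) :
    (ψ !₂[a₁, b₁] - ψ !₂[a₂, b₂]) ^ 2 ≤ L ^ 2 * ((a₁ - a₂) ^ 2 + (b₁ - b₂) ^ 2) := by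
  have h := hψ.dist_le_mul !₂[a₁, b₁] !₂[a₂, b₂]
  have h2 := pow_le_pow_left₀ dist_nonneg h 2
  rw [mul_pow, EuclideanSpace.dist_eq, Real.sq_sqrt (by positivity), Real.dist_eq, sq_abs] at h2
  simpa [Real.dist_eq] using h2

theorem norm_sq_phase_rate_le (hε : 0 < ε) {L : ℝ≥0} {ψ : EuclideanSpace ℝ (Fin 2) → ℝ}
    (hψ : LipschitzWith L ψ) {p₁ p₂ h₁ h₂ k₁ k₂ : H Ω} {v v₁ v₂ : E n → ℝ}
    (hv : Integrable (fun x => v x ^ 2) (volume.restrict Ω))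
    (hvv : ∀ᵐ x ∂volume.restrict Ω, v x = v₁ x - v₂ x)
    (e₁ : ∀ᵐ x ∂volume.restrict Ω, ε * p₁ x = ψ !₂[h₁ x + v₁ x, k₁ x])
    (e₂ : ∀ᵐ x ∂volume.restrict Ω, ε * p₂ x = ψ !₂[h₂ x + v₂ x, k₂ x]) :
    ‖p₁ - p₂‖ ^ 2 ≤
      (L / ε) ^ 2 * (2 * ‖h₁ - h₂‖ ^ 2 + 2 * (∫ x in Ω, v x ^ 2) + ‖k₁ - k₂‖ ^ 2) := by
  refine norm_sq_le_of_ae_sq_le hv ?_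
  filter_upwards [hvv, e₁, e₂, Lp.coeFn_sub p₁ p₂, Lp.coeFn_sub h₁ h₂, Lp.coeFn_sub k₁ k₂]
    with x hx x1 x2 hp hh hk
  rw [hx, hp, hh, hk]
  simp only [Pi.sub_apply]
  have h := hψ.sq_sub_le (h₁ x + v₁ x) (k₁ x) (h₂ x + v₂ x) (k₂ x)
  rw [← x1, ← x2, ← mul_sub, mul_pow] at h
  rw [div_pow, div_mul_eq_mul_div, le_div_iff₀ (by positivity), mul_comm]
  refine h.trans (mul_le_mul_of_nonneg_left ?_ (by positivity))
  -- Here `(h + v)² ≤ 2 h² + 2 v²` for the differences `h` and `v`, the source of the factors `2`.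
  nlinarith [sq_nonneg ((h₁ x - h₂ x) - (v₁ x - v₂ x))]

/-- Testing with `θ` produces `-2‖∇θ‖²`. Young gives `2‖h₂‖‖θ‖_V ≤ ‖h₂‖² + ‖θ‖_H² + ‖∇θ‖²`, whose
gradient is absorbed. The two products with `p` cost `2‖p‖² + ‖θ‖_H² + ‖χ‖²`. Inserting the bound on
`‖p‖²` yields `2 + 4c` in front of `‖θ‖_H²`, and less in front of `‖χ‖²`. -/
theorem energy_rate_le {c N : ℝ} {θ : V Ω Γ₀} {g h₂ : V' Ω Γ₀} {χ p h₁ : H Ω}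
    (hg : g + toDual Ω Γ₀ p + A Ω Γ₀ θ = toDual Ω Γ₀ h₁ + h₂)
    (hp : ‖p‖ ^ 2 ≤ c * (2 * ‖toH Ω Γ₀ θ‖ ^ 2 + 2 * N + ‖χ‖ ^ 2)) (hc : 0 ≤ c) :
    2 * (g θ + inner ℝ p χ) ≤ 2 * (‖h₁‖ * ‖toH Ω Γ₀ θ‖) + (‖h₂‖ ^ 2 + 4 * c * N) +
      (2 + 4 * c) * (‖toH Ω Γ₀ θ‖ ^ 2 + ‖χ‖ ^ 2) := by
  have e := congrArg (fun F : V' Ω Γ₀ => F θ) hg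
  simp only [add_apply, toDual_apply, A_apply_self] at e
  have b1 : inner ℝ h₁ (toH Ω Γ₀ θ) ≤ ‖h₁‖ * ‖toH Ω Γ₀ θ‖ := real_inner_le_norm _ _
  have b2 : h₂ θ ≤ ‖h₂‖ * ‖θ‖ := (le_abs_self _).trans (h₂.le_opNorm θ)
  have b3 := norm_sq_V θ
  have b4 : -inner ℝ p (toH Ω Γ₀ θ) ≤ ‖p‖ * ‖toH Ω Γ₀ θ‖ :=
    (neg_le_abs _).trans (abs_real_inner_le_norm _ _)
  have b5 : inner ℝ p χ ≤ ‖p‖ * ‖χ‖ := real_inner_le_norm _ _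
  have b6 : 0 ≤ c * ‖χ‖ ^ 2 := by positivity
  have b7 := sq_nonneg ‖χ‖
  nlinarith [sq_nonneg (‖h₂‖ - ‖θ‖), sq_nonneg (‖p‖ - ‖toH Ω Γ₀ θ‖), sq_nonneg (‖p‖ - ‖χ‖)]

theorem StefanRelaxation.IsSolution.norm_sq_sub_le_of_isDecomposition (hT : 0 < T) (hε : 0 < ε)
    {L : ℝ≥0} {ψ : EuclideanSpace ℝ (Fin 2) → ℝ} (hψ : LipschitzWith L ψ)
    {f₁ f₂ : ℝ → V' Ω Γ₀} {u₁ u₂ : L2Q T Ω} {θ₀₁ θ₀₂ χ₀₁ χ₀₂ : H Ω}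
    {θ₁ θ₂ : ℝ → V Ω Γ₀} {χ₁ χ₂ : ℝ → H Ω}
    (s₁ : IsSolution T ε Ω Γ₀ ψ f₁ u₁ θ₀₁ χ₀₁ θ₁ χ₁)
    (s₂ : IsSolution T ε Ω Γ₀ ψ f₂ u₂ θ₀₂ χ₀₂ θ₂ χ₂)
    {θc₁ θc₂ χc₁ χc₂ : ℝ → H Ω}
    (hθ₁ : IsContRep T (fun t => toH Ω Γ₀ (θ₁ t)) θc₁)
    (hθ₂ : IsContRep T (fun t => toH Ω Γ₀ (θ₂ t)) θc₂)
    (hχ₁ : IsContRep T χ₁ χc₁) (hχ₂ : IsContRep T χ₂ χc₂)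
    {h₁ : Lp (H Ω) 1 (timeMeasure T)} {h₂ : Lp (V' Ω Γ₀) 2 (timeMeasure T)}
    (hdec : IsDecomposition T Ω Γ₀ (fun t => f₁ t - f₂ t) h₁ h₂) :
    ∀ t ∈ Icc 0 T, ‖θc₁ t - θc₂ t‖ ^ 2 + ‖χc₁ t - χc₂ t‖ ^ 2 ≤
      2 * ((‖θc₁ 0 - θc₂ 0‖ ^ 2 + ‖χc₁ 0 - χc₂ 0‖ ^ 2 + (‖h₂‖ ^ 2 + 4 * (L / ε) ^ 2 *
        ‖u₁ - u₂‖ ^ 2)) * Real.exp ((2 + 4 * (L / ε) ^ 2) * T)) +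
      4 * (‖h₁‖ * Real.exp ((2 + 4 * (L / ε) ^ 2) * T)) ^ 2 := by
  obtain ⟨g₁, p₁, m₁, dθ₁, dχ₁, eq₁, ψ₁, -, -⟩ := s₁
  obtain ⟨g₂, p₂, m₂, dθ₂, dχ₂, eq₂, ψ₂, -, -⟩ := s₂
  have dθ : HasH1Deriv T (fun t => toDual Ω Γ₀ (toH Ω Γ₀ (θ₁ t - θ₂ t)))
      (fun t => g₁ t - g₂ t) := by
    simpa only [map_sub] using dθ₁.sub dθ₂
  have hθ : IsContRep T (fun t => toH Ω Γ₀ (θ₁ t - θ₂ t)) (fun t => θc₁ t - θc₂ t) := by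
    simpa only [map_sub] using hθ₁.sub hθ₂
  have dχ : HasH1Deriv T (fun t => χ₁ t - χ₂ t) (fun t => p₁ t - p₂ t) := dχ₁.sub dχ₂
  have hχ : IsContRep T (fun t => χ₁ t - χ₂ t) (fun t => χc₁ t - χc₂ t) := hχ₁.sub hχ₂
  have mθ : MemLp (fun t => θ₁ t - θ₂ t) 2 (timeMeasure T) := m₁.sub m₂
  have enθ := dθ.norm_sq_isContRep_toH hT mθ hθ
  have enχ := dχ.norm_sq_isContRep hT hχ
  obtain ⟨uslice, uint, unorm⟩ := integral_sq_slice_L2Q (u₁ - u₂)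
  set c : ℝ := (L / ε) ^ 2 with hc
  have hc0 : 0 ≤ c := by positivity
  set e : ℝ → ℝ := fun t => ‖θc₁ t - θc₂ t‖ ^ 2 + ‖χc₁ t - χc₂ t‖ ^ 2 with he
  have hec : ContinuousOn e (Icc 0 T) := (hθ.1.norm.pow 2).add (hχ.1.norm.pow 2)
  have he0 : ∀ t, 0 ≤ e t := fun t => by positivity
  have hrate : ∀ᵐ t ∂timeMeasure T,
      2 * ((g₁ t - g₂ t) (θ₁ t - θ₂ t) + inner ℝ (p₁ t - p₂ t) (χ₁ t - χ₂ t)) ≤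
        2 * (‖h₁ t‖ * √(e t)) +
        (‖h₂ t‖ ^ 2 + 4 * c * ∫ x in Ω, (u₁ - u₂) (t, x) ^ 2) + (2 + 4 * c) * e t := by
    filter_upwards [hdec, eq₁, eq₂, ψ₁, ψ₂, hθ.2, hχ.2, uslice,
      ae_ae_of_ae_L2Q (Lp.coeFn_sub u₁ u₂)] with t hd q1 q2 r1 r2 cθ cχ us ud
    have hp := norm_sq_phase_rate_le hε hψ us ud r1 r2
    rw [← map_sub, ← hc] at hp
    have hg : (g₁ t - g₂ t) + toDual Ω Γ₀ (p₁ t - p₂ t) + A Ω Γ₀ (θ₁ t - θ₂ t) =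
        toDual Ω Γ₀ (h₁ t) + h₂ t := by
      rw [← hd, ← q1, ← q2, map_sub, map_sub]
      abel
    have hrate := energy_rate_le hg hp hc0
    have hle : ‖θc₁ t - θc₂ t‖ ≤ √(e t) :=
      Real.le_sqrt_of_sq_le (le_add_of_nonneg_right (sq_nonneg _))
    have := mul_le_mul_of_nonneg_left hle (norm_nonneg (h₁ t))
    have he' : e t = ‖θc₁ t - θc₂ t‖ ^ 2 + ‖χc₁ t - χc₂ t‖ ^ 2 := rfl
    rw [cθ] at this
    rw [cθ, cχ] at he'
    rw [← he'] at hrate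
    linarith
  have ih₂ : Integrable (fun t => ‖h₂ t‖ ^ 2) (timeMeasure T) := (Lp.memLp h₂).norm.integrable_sq
  have iθ : Integrable (fun t => (g₁ t - g₂ t) (θ₁ t - θ₂ t)) (timeMeasure T) :=
    dθ.memLp_deriv.integrable_dual_apply mθ
  have iχ : Integrable (fun t => inner ℝ (p₁ t - p₂ t) (χ₁ t - χ₂ t)) (timeMeasure T) :=
    ((innerSL ℝ : H Ω →L[ℝ] StrongDual ℝ (H Ω)).comp_memLp' dχ.memLp_deriv).integrable_dual_apply
      dχ.memLp
  have key := le_of_ae_rate_le hT (by positivity) hec he0 ((iθ.add iχ).const_mul 2)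
    (L1.integrable_coeFn h₁).norm (ih₂.add (uint.const_mul _)) (fun _ => norm_nonneg _)
    (fun t => add_nonneg (sq_nonneg _) (mul_nonneg (by positivity)
      (integral_nonneg fun _ => sq_nonneg _))) hrate fun t ht => by
      have hres : (volume.restrict (Ioo 0 t) : Measure ℝ) ≤ timeMeasure T :=
        Measure.restrict_mono (Ioo_subset_Ioo le_rfl ht.2) le_rfl
      simp only [Pi.add_apply]
      rw [integral_const_mul, integral_add (iθ.mono_measure hres) (iχ.mono_measure hres)]
      have k1 := enθ t ht
      have k2 := enχ t ht
      simp only [he]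
      linarith
  simp only [Pi.add_apply] at key
  rw [integral_add ih₂ (uint.const_mul _), integral_const_mul, unorm, ← norm_sq_eq_integral,
    ← L1.norm_eq_integral_norm] at key
  exact key

theorem StefanRelaxation.IsSolution.norm_sq_sub_le (hT : 0 < T) (hε : 0 < ε)
    {L : ℝ≥0} {ψ : EuclideanSpace ℝ (Fin 2) → ℝ} (hψ : LipschitzWith L ψ)
    {f₁ f₂ : ℝ → V' Ω Γ₀} (hf₁ : MemSum T Ω Γ₀ f₁) (hf₂ : MemSum T Ω Γ₀ f₂)
    {u₁ u₂ : L2Q T Ω} {θ₀₁ θ₀₂ χ₀₁ χ₀₂ : H Ω} {θ₁ θ₂ : ℝ → V Ω Γ₀} {χ₁ χ₂ : ℝ → H Ω}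
    (s₁ : IsSolution T ε Ω Γ₀ ψ f₁ u₁ θ₀₁ χ₀₁ θ₁ χ₁)
    (s₂ : IsSolution T ε Ω Γ₀ ψ f₂ u₂ θ₀₂ χ₀₂ θ₂ χ₂)
    {θc₁ θc₂ χc₁ χc₂ : ℝ → H Ω}
    (hθ₁ : IsContRep T (fun t => toH Ω Γ₀ (θ₁ t)) θc₁)
    (hθ₂ : IsContRep T (fun t => toH Ω Γ₀ (θ₂ t)) θc₂)
    (hχ₁ : IsContRep T χ₁ χc₁) (hχ₂ : IsContRep T χ₂ χc₂) {C : ℝ}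
    (hC : 2 * ((1 + 4 * (L / ε) ^ 2) * Real.exp ((2 + 4 * (L / ε) ^ 2) * T)) +
      4 * Real.exp ((2 + 4 * (L / ε) ^ 2) * T) ^ 2 ≤ C) :
    ∀ t ∈ Icc 0 T, ‖θc₁ t - θc₂ t‖ ^ 2 + ‖χc₁ t - χc₂ t‖ ^ 2 ≤
      C * (‖θc₁ 0 - θc₂ 0‖ ^ 2 + ‖χc₁ 0 - χc₂ 0‖ ^ 2) +
      C * (sumNorm T Ω Γ₀ (fun t => f₁ t - f₂ t) ^ 2 + ‖u₁ - u₂‖ ^ 2) := by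
  intro t ht
  refine (hf₁.sub hf₂).le_sumNorm fun h₁ h₂ hdec => ?_
  refine (s₁.norm_sq_sub_le_of_isDecomposition hT hε hψ s₂ hθ₁ hθ₂ hχ₁ hχ₂ hdec t ht).trans ?_
  set x := Real.exp ((2 + 4 * (L / ε) ^ 2) * T)
  set c : ℝ := (L / ε) ^ 2
  have hx : 0 < x := Real.exp_pos _
  have hc : 0 ≤ c := sq_nonneg _
  set a := ‖θc₁ 0 - θc₂ 0‖ ^ 2 + ‖χc₁ 0 - χc₂ 0‖ ^ 2
  have ha : 0 ≤ a := by positivity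
  set U := ‖u₁ - u₂‖ ^ 2
  have hU : 0 ≤ U := by positivity
  have hcx : 0 ≤ c * x := by positivity
  have n1 := norm_nonneg h₁
  have n2 := norm_nonneg h₂
  have r1 : ‖h₁‖ ^ 2 ≤ (‖h₁‖ + ‖h₂‖) ^ 2 := by gcongr; linarith
  have r2 : ‖h₂‖ ^ 2 ≤ (‖h₁‖ + ‖h₂‖) ^ 2 := by gcongr; linarith
  set R := (‖h₁‖ + ‖h₂‖) ^ 2
  have hR : 0 ≤ R := by positivity
  -- The coefficients of the initial data, of the squared source norm and of `‖u₁ - u₂‖²` are each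
  -- dominated by `C`.
  have c1 : 2 * x ≤ C := by nlinarith [sq_nonneg x]
  have c2 : 2 * x + 4 * x ^ 2 ≤ C := by nlinarith
  have c3 : 8 * (c * x) ≤ C := by nlinarith [sq_nonneg x]
  have t1 := mul_le_mul_of_nonneg_right c1 ha
  have t2 := mul_le_mul_of_nonneg_right c2 hR
  have t3 := mul_le_mul_of_nonneg_right c3 hU
  have t4 := mul_le_mul_of_nonneg_left r2 (by positivity : 0 ≤ 2 * x)
  have t5 := mul_le_mul_of_nonneg_left r1 (by positivity : 0 ≤ 4 * x ^ 2)
  linear_combination t1 + t2 + t3 + t4 + t5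

end Estimate

theorem proposition3p1 (T ε : ℝ) (hT : 0 < T) (hε : 0 < ε) (L : ℝ≥0) :
    ∃ C : ℝ, 0 < C ∧
      ∀ (n : ℕ) (_ : 1 ≤ n) (Ω Γ₀ Γ₁ : Set (E n))
        (_ : IsMixedDomain Ω Γ₀ Γ₁)
        (ψ : EuclideanSpace ℝ (Fin 2) → ℝ) (_ : LipschitzWith L ψ),
        (∀ (f₁ f₂ : ℝ → V' Ω Γ₀)
          (_ : MemSum T Ω Γ₀ f₁) (_ : MemSum T Ω Γ₀ f₂)
          (u₁ u₂ : L2Q T Ω)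
          (θ₀₁ θ₀₂ χ₀₁ χ₀₂ : H Ω)
          (θ₁ θ₂ : ℝ → V Ω Γ₀) (χ₁ χ₂ : ℝ → H Ω)
          (_ : IsSolution T ε Ω Γ₀ ψ f₁ u₁ θ₀₁ χ₀₁ θ₁ χ₁)
          (_ : IsSolution T ε Ω Γ₀ ψ f₂ u₂ θ₀₂ χ₀₂ θ₂ χ₂),
          -- the continuous representatives, with values in `H`, of the two solutions
          ∃ θc₁ θc₂ χc₁ χc₂ : ℝ → H Ω,
            IsContRep T (fun t => toH Ω Γ₀ (θ₁ t)) θc₁ ∧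
            IsContRep T (fun t => toH Ω Γ₀ (θ₂ t)) θc₂ ∧
            IsContRep T χ₁ χc₁ ∧
            IsContRep T χ₂ χc₂ ∧
            θc₁ 0 = θ₀₁ ∧ θc₂ 0 = θ₀₂ ∧ χc₁ 0 = χ₀₁ ∧ χc₂ 0 = χ₀₂ ∧
            ∀ t ∈ Icc 0 T,
              ‖θc₁ t - θc₂ t‖ ^ 2 + ‖χc₁ t - χc₂ t‖ ^ 2 ≤
                C * (‖θ₀₁ - θ₀₂‖ ^ 2 + ‖χ₀₁ - χ₀₂‖ ^ 2) +
                C * (sumNorm T Ω Γ₀ (fun t => f₁ t - f₂ t) ^ 2 +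
                  ‖u₁ - u₂‖ ^ 2)) ∧
        -- the problem has at most one solution
        (∀ (f : ℝ → V' Ω Γ₀) (_ : MemSum T Ω Γ₀ f)
          (u : L2Q T Ω) (θ₀ χ₀ : H Ω)
          (θ₁ θ₂ : ℝ → V Ω Γ₀) (χ₁ χ₂ : ℝ → H Ω)
          (_ : IsSolution T ε Ω Γ₀ ψ f u θ₀ χ₀ θ₁ χ₁)
          (_ : IsSolution T ε Ω Γ₀ ψ f u θ₀ χ₀ θ₂ χ₂),
          ∀ᵐ t ∂timeMeasure T, θ₁ t = θ₂ t ∧ χ₁ t = χ₂ t) := by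
  -- The sum of the coefficients in the estimate with a fixed decomposition; it involves only `T`,
  -- `ε` and `L`.
  set c₀ : ℝ := 2 * ((1 + 4 * (L / ε) ^ 2) * Real.exp ((2 + 4 * (L / ε) ^ 2) * T)) +
    4 * Real.exp ((2 + 4 * (L / ε) ^ 2) * T) ^ 2
  refine ⟨c₀, by positivity, fun n _ Ω Γ₀ Γ₁ hΩ ψ hψ => ⟨?_, ?_⟩⟩
  · intro f₁ f₂ hf₁ hf₂ u₁ u₂ θ₀₁ θ₀₂ χ₀₁ χ₀₂ θ₁ θ₂ χ₁ χ₂ s₁ s₂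
    obtain ⟨θc₁, χc₁, hθ₁, hχ₁, rfl, rfl⟩ := s₁.exists_isContRep hT hΩ
    obtain ⟨θc₂, χc₂, hθ₂, hχ₂, rfl, rfl⟩ := s₂.exists_isContRep hT hΩ
    exact ⟨θc₁, θc₂, χc₁, χc₂, hθ₁, hθ₂, hχ₁, hχ₂, rfl, rfl, rfl, rfl,
      s₁.norm_sq_sub_le hT hε hψ hf₁ hf₂ s₂ hθ₁ hθ₂ hχ₁ hχ₂ le_rfl⟩
  · intro f hf u θ₀ χ₀ θ₁ θ₂ χ₁ χ₂ s₁ s₂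
    obtain ⟨θc₁, χc₁, hθ₁, hχ₁, z₁, y₁⟩ := s₁.exists_isContRep hT hΩ
    obtain ⟨θc₂, χc₂, hθ₂, hχ₂, z₂, y₂⟩ := s₂.exists_isContRep hT hΩ
    have h := s₁.norm_sq_sub_le hT hε hψ hf hf s₂ hθ₁ hθ₂ hχ₁ hχ₂ le_rfl
    simp only [z₁, z₂, y₁, y₂, sub_self, sumNorm_zero, norm_zero] at h
    filter_upwards [hθ₁.2, hθ₂.2, hχ₁.2, hχ₂.2, ae_restrict_mem measurableSet_Ioo]
      with t a₁ a₂ b₁ b₂ ht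
    have ht' := h t (Ioo_subset_Icc_self ht)
    have k1 : ‖θc₁ t - θc₂ t‖ ^ 2 = 0 := by
      nlinarith [sq_nonneg ‖θc₁ t - θc₂ t‖, sq_nonneg ‖χc₁ t - χc₂ t‖]
    have k2 : ‖χc₁ t - χc₂ t‖ ^ 2 = 0 := by
      nlinarith [sq_nonneg ‖θc₁ t - θc₂ t‖, sq_nonneg ‖χc₁ t - χc₂ t‖]
    rw [sq_eq_zero_iff, norm_eq_zero, sub_eq_zero] at k1 k2
    -- Equality in `H` lifts to equality in `V`, since the gradient is determined by the function.
    refine ⟨toH_injective hΩ.isOpen ?_, ?_⟩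
    · rw [← a₁, ← a₂, k1]
    · rw [← b₁, ← b₂, k2]
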